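/- **Setting.** An instance of $P\|C_{\max}$ consists of a number $m\ge 1$ of identical machines (part of the input) and processing times $p_1,\dots,p_n\in\mathbb N$. A schedule $S$ assigns every job to a machine; the completion time $C_S(i)$ of machine $i$ is the sum of the processing times of its jobs, and the makespan of $S$ is $\max_i C_S(i)$. **Relaxation.** For a set $J$ of jobs with processing times $p_j$, overheads $t_1,\dots,t_m$ and a time limit $T$, consider the polyhedron in the variables $x_{j,i}\ge 0$ ($j\in J$, $i\in[m]$, $p_j\le T$) given by $\sum_i x_{j,i}=1$ for $j\in J$ and $\sum_j p_jx_{j,i}\le T-t_i$ for $i\in[m]$. A job is fractional in $x$ if some $x_{j,i}\notin\{0,1\}$. **The algorithm $A^{\text{eq-prof}}_\varepsilon$** ($\varepsilon>0$). It orders the jobs so that $p_1\ge\dots\ge p_n$ and divides all processing times by the smallest integer $T_0$ for which the relaxation of the whole instance (no overheads) is feasible. A node $v$ of the branching tree fixes some jobs on machines; its overhead vector $t_v$ is the vector of completion times of the fixed jobs, and its lower bound $LB(v)$ is the smallest time limit (an integer multiple of $1/T_0$, i.e. an integer in the units of the input) for which the relaxation with the unfixed jobs and overheads $t_v$ is feasible.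 The root fixes nothing and is the first active node. In each iteration, the algorithm processes one active node $v$ with smallest lower bound, as follows. It finds a vertex of the relaxation at $v$ with time limit $LB(v)$. If no job is fractional in it, this schedule is a candidate and the algorithm stops. Otherwise it takes a vertex of the same polyhedron in which the longest unfixed job is fractional (the vertex already found, if it has this property) and rounds it to a schedule: fixed and integral jobs stay, and the fractional jobs are matched injectively to machines $i$ with $x_{j,i}\neq0$. Then $v$ is no longer active, and the $m$ nodes obtained by fixing the longest unfixed job on machine $1,\dots,m$ are examined one after the other. A new node $u$ is discarded if a schedule with makespan less than $LB(u)$ has been found, or if some entry of $t_u$ exceeds $2(1+\varepsilon)^2$, or if the tree already contains a node of the same depth that is $\varepsilon$-equivalent to $u$; otherwise $u$ is added to the tree and to the active nodes. The algorithm stops as soon as $LUB\le(1+\varepsilon)LLB$, where $LUB$ is the smallest makespan of a schedule found so far and $LLB$ is the smallest lower bound of an active node ($\infty$ if there is none). It returns the best schedule found. Two nodes are *$\varepsilon$-equivalent* if, after every processing time is rounded down to the largest number $\varepsilon(1+\varepsilon)^k$, $k\in\mathbb N$, not exceeding it (to $0$ if it is below $\varepsilon$), they have, for every number $c$, the same number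 of machines whose completion time is $c$. **Theorem.** There is a function $f:\mathbb R\to\mathbb N$ such that, for every $\varepsilon>0$ and every instance, and whichever way the free choices of the algorithm are made (the order of jobs of equal length, the node among those with smallest lower bound, the vertices, the matching), the algorithm $A^{\text{eq-prof}}_\varepsilon$ never gets blocked, stops after finitely many iterations, and returns a schedule whose makespan is at most $(1+\varepsilon)^2$ times the minimum makespan. If $m\ge2$ or $\varepsilon\le2$, it processes at most $\dfrac{2\,m^{f(\varepsilon)+1}}{\varepsilon}$ nodes of the branching tree. -/

import Mathlib

namespace EqProf

open Finset

/-! ### Schedules on `m` identical machines -/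

/-- Completion time of machine `i` in the schedule `S` with processing times `p`. -/
def completion {n m : ℕ} (p : Fin n → ℝ) (S : Fin n → Fin m) (i : Fin m) : ℝ :=
  ∑ j with S j = i, p j

/-- Makespan: the largest completion time. -/
noncomputable def makespan {n m : ℕ} (p : Fin n → ℝ) (S : Fin n → Fin m) : ℝ :=
  ⨆ i, completion p S i

/-! ### Nodes of the branching tree -/

/-- A node is the set of job-machine pairings fixed at it: `v j = some i` means that job `j` is
fixed on machine `i`, and `v j = none` that job `j` is not fixed. -/
abbrev Node (n m : ℕ) : Type := Fin n → Option (Fin m)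

/-- The jobs that are not fixed at `v`. -/
def unfixed {n m : ℕ} (v : Node n m) : Finset (Fin n) := {j | v j = none}

/-- The depth of `v` in the tree: one job is fixed per level. -/
def depth {n m : ℕ} (v : Node n m) : ℕ := #{j | v j ≠ none}

/-- The overhead of machine `i` at `v`: its completion time in the partial schedule `v`. -/
def overhead {n m : ℕ} (p : Fin n → ℝ) (v : Node n m) (i : Fin m) : ℝ :=
  ∑ j with v j = some i, p j

/-! ### The linear relaxation with parametric pruning -/

/-- The polyhedron of the fractional schedules of the jobs in `J` on machines with overheads `t`
and time limit `T`, where pairings `(j, i)` with `p j > T` are not allowed. The variables of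
pairings that do not occur are set to `0`. -/
def partialLP {n m : ℕ} (J : Finset (Fin n)) (p : Fin n → ℝ) (t : Fin m → ℝ) (T : ℝ) :
    Set (Fin n → Fin m → ℝ) :=
  {x | (∀ j ∈ J, ∑ i, x j i = 1) ∧
       (∀ i, ∑ j ∈ J, p j * x j i ≤ T - t i) ∧
       (∀ j i, 0 ≤ x j i) ∧
       (∀ j i, j ∉ J ∨ T < p j → x j i = 0)}

/-- The global fractional optimum: the smallest integer time limit for which the relaxation of the
whole instance (integer processing times, no overheads) is feasible. -/
noncomputable def globalOpt {n : ℕ} (m : ℕ) (p : Fin n → ℕ) : ℕ :=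
  sInf {T : ℕ |
    (partialLP univ (fun j => (p j : ℝ)) (fun _ : Fin m => (0 : ℝ)) (T : ℝ)).Nonempty}

/-- The instance on which the branch-and-bound works: the jobs are rearranged by `σ`, and the
processing times are divided by the global fractional optimum. -/
noncomputable def normalized {n : ℕ} (m : ℕ) (p : Fin n → ℕ) (σ : Equiv.Perm (Fin n)) :
    Fin n → ℝ :=
  fun k => (p (σ k) : ℝ) / (globalOpt m p : ℝ)

/-- The local lower bound `LB(v)`: the smallest time limit for which the relaxation of the
sub-problem at `v` is feasible. Time limits are integers in the units of the input, so after the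
division by `T₀` they are the multiples of `1 / T₀`. -/
noncomputable def lowerBound {n m : ℕ} (T₀ : ℕ) (q : Fin n → ℝ) (v : Node n m) : ℝ :=
  ((sInf {k : ℕ | (partialLP (unfixed v) q (overhead q v) ((k : ℝ) / (T₀ : ℝ))).Nonempty} : ℕ) : ℝ)
    / (T₀ : ℝ)

/-- `x` is a vertex of the relaxation at `v` with the smallest feasible time limit. -/
def IsVertex {n m : ℕ} (T₀ : ℕ) (q : Fin n → ℝ) (v : Node n m) (x : Fin n → Fin m → ℝ) : Prop :=
  x ∈ (partialLP (unfixed v) q (overhead q v) (lowerBound T₀ q v)).extremePoints ℝ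

/-- Job `j` is fractional in `x`. -/
def Fractional {n m : ℕ} (x : Fin n → Fin m → ℝ) (j : Fin n) : Prop :=
  ∃ i, x j i ≠ 0 ∧ x j i ≠ 1

/-- `S` is a rounding of the fractional schedule `x` at `v`: fixed jobs and integral jobs stay
where they are, and the fractional jobs are matched injectively to machines that process a part of
them in `x`. -/
def IsRounding {n m : ℕ} (v : Node n m) (x : Fin n → Fin m → ℝ) (S : Fin n → Fin m) : Prop :=
  (∀ j i, v j = some i → S j = i) ∧
  (∀ j ∈ unfixed v, ¬ Fractional x j → x j (S j) = 1) ∧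
  (∀ j, Fractional x j → x j (S j) ≠ 0) ∧
  Set.InjOn S {j | Fractional x j}

/-! ### Profiles and equivalence -/

/-- Rounding down to the geometric sequence `ε, ε (1 + ε), ε (1 + ε)², …`. A number below `ε` is
sent to `0`: small jobs do not contribute to a profile. -/
noncomputable def geomRound (ε x : ℝ) : ℝ :=
  sSup {y : ℝ | ∃ k : ℕ, y = ε * (1 + ε) ^ k ∧ y ≤ x}

open Classical in
/-- The profile of the partial schedule `v`: for each number `c`, how many machines have completion
time `c` after each processing time is rounded down (the count is `0` for all other `c`). -/
noncomputable def profile {n m : ℕ} (ε : ℝ) (q : Fin n → ℝ) (v : Node n m) (c : ℝ) : ℕ :=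
  #{i : Fin m | overhead (fun j => geomRound ε (q j)) v i = c}

/-- Equivalence of partial schedules: equal profiles. -/
def Equivalent {n m : ℕ} (ε : ℝ) (q : Fin n → ℝ) (v w : Node n m) : Prop :=
  profile ε q v = profile ε q w

/-! ### The branch-and-bound algorithm -/

/-- What the algorithm stores: the active nodes, all nodes that were ever added to the tree (their
profiles form the list of profiles), the best schedule found so far, the number of processed nodes,
and whether it has stopped. -/
structure State (n m : ℕ) where
  active : Finset (Node n m)
  listed : Finset (Node n m)
  best : Option (Fin n → Fin m)
  processed : ℕ
  halted : Bool

/-- At the beginning, the tree consists of the root, where no job is fixed. -/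
def initial (n m : ℕ) : State n m where
  active := {fun _ => none}
  listed := {fun _ => none}
  best := none
  processed := 0
  halted := false

open Classical in
/-- The best schedule found so far, after `S` has been found. -/
noncomputable def champion {n m : ℕ} (q : Fin n → ℝ) (best : Option (Fin n → Fin m))
    (S : Fin n → Fin m) : Fin n → Fin m :=
  match best with
  | none => S
  | some B => if makespan q S < makespan q B then S else B

/-- The new node `u` is discarded: the best schedule `B` is better than `LB(u)`, or a completion
time at `u` exceeds `2 (1 + ε)²`, or a node of the same depth with an equivalent profile is already
in the tree. -/
def Discarded {n m : ℕ} (ε : ℝ) (T₀ : ℕ) (q : Fin n → ℝ) (B : Fin n → Fin m)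
    (listed : Finset (Node n m)) (u : Node n m) : Prop :=
  makespan q B < lowerBound T₀ q u ∨
  (∃ i, 2 * (1 + ε) ^ 2 < overhead q u i) ∨
  ∃ w ∈ listed, depth w = depth u ∧ Equivalent ε q w u

open Classical in
/-- Add the new node `u` to the active nodes and to the list, unless it is discarded. -/
noncomputable def addNode {n m : ℕ} (ε : ℝ) (T₀ : ℕ) (q : Fin n → ℝ) (B : Fin n → Fin m)
    (a : Finset (Node n m) × Finset (Node n m)) (u : Node n m) :
    Finset (Node n m) × Finset (Node n m) :=
  if Discarded ε T₀ q B a.2 u then a else (insert u a.1, insert u a.2)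

/-- Branching at `v` on job `j`: `v` is no longer active, and the `m` nodes obtained by fixing `j`
on machine `0, 1, …, m - 1` are examined one after the other. The result is the new set of active
nodes and the new list. -/
noncomputable def branch {n m : ℕ} (ε : ℝ) (T₀ : ℕ) (q : Fin n → ℝ) (B : Fin n → Fin m)
    (s : State n m) (v : Node n m) (j : Fin n) : Finset (Node n m) × Finset (Node n m) :=
  (List.finRange m).foldl (fun a i => addNode ε T₀ q B a (Function.update v j (some i)))
    (s.active.erase v, s.listed)

/-- The stopping criterion `LUB / LLB ≤ 1 + ε`, where `LUB` is the makespan of the best schedule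
`B`, and `LLB` is the smallest lower bound of an active node (`∞` if there is none). -/
def Stops {n m : ℕ} (ε : ℝ) (T₀ : ℕ) (q : Fin n → ℝ) (B : Fin n → Fin m)
    (active : Finset (Node n m)) : Prop :=
  ∀ w ∈ active, makespan q B ≤ (1 + ε) * lowerBound T₀ q w

/-- In the state `s`, the algorithm may select the node `v` (best-first: its lower bound is the
smallest among the active nodes) and find the vertex `x` of the relaxation at `v`. -/
def Selects {n m : ℕ} (T₀ : ℕ) (q : Fin n → ℝ) (s : State n m) (v : Node n m)
    (x : Fin n → Fin m → ℝ) : Prop :=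
  v ∈ s.active ∧ (∀ w ∈ s.active, lowerBound T₀ q v ≤ lowerBound T₀ q w) ∧ IsVertex T₀ q v x

open Classical in
/-- Processing the selected node `v` with the vertex `x` can lead from `s` to the given state.
The jobs are assumed to be in decreasing order, so the longest unfixed job is the one with the
smallest index.
* If `x` is integral, the algorithm stops.
* Otherwise it takes a vertex `y` in which the longest unfixed job `j` is fractional (`x` itself, if
  possible), rounds it to a schedule `S`, branches on `j`, and checks the stopping criterion. -/
inductive Processes {n m : ℕ} (ε : ℝ) (T₀ : ℕ) (q : Fin n → ℝ) (s : State n m) (v : Node n m)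
    (x : Fin n → Fin m → ℝ) : State n m → Prop
  | integral (S : Fin n → Fin m)
      (hx : ∀ j, ¬ Fractional x j)
      (hS : IsRounding v x S) :
      Processes ε T₀ q s v x
        { active := s.active.erase v
          listed := s.listed
          best := some (champion q s.best S)
          processed := s.processed + 1
          halted := true }
  | fractional (y : Fin n → Fin m → ℝ) (j : Fin n) (S : Fin n → Fin m)
      (hx : ∃ k, Fractional x k)
      (hj : IsLeast (unfixed v : Set (Fin n)) j)
      (hy : IsVertex T₀ q v y)
      (hyj : Fractional y j)
      (hxy : Fractional x j → y = x)
      (hS : IsRounding v y S) :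
      Processes ε T₀ q s v x
        { active := (branch ε T₀ q (champion q s.best S) s v j).1
          listed := (branch ε T₀ q (champion q s.best S) s v j).2
          best := some (champion q s.best S)
          processed := s.processed + 1
          halted := decide (Stops ε T₀ q (champion q s.best S)
            (branch ε T₀ q (champion q s.best S) s v j).1) }

/-- One iteration of the algorithm: a node is selected and processed. -/
def Step {n m : ℕ} (ε : ℝ) (T₀ : ℕ) (q : Fin n → ℝ) (s s' : State n m) : Prop :=
  s.halted = false ∧ ∃ v x, Selects T₀ q s v x ∧ Processes ε T₀ q s v x s'

/-- An iteration of the algorithm on the instance of `P || C_max` with `m` machines and processing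
times `p`, where `σ` is the rearrangement of the jobs. -/
def AlgStep {n : ℕ} (ε : ℝ) (m : ℕ) (p : Fin n → ℕ) (σ : Equiv.Perm (Fin n))
    (s s' : State n m) : Prop :=
  Step ε (globalOpt m p) (normalized m p σ) s s'

/-- The states that some execution of the algorithm reaches. -/
def Reachable {n : ℕ} (ε : ℝ) (m : ℕ) (p : Fin n → ℕ) (σ : Equiv.Perm (Fin n))
    (s : State n m) : Prop :=
  Relation.ReflTransGen (AlgStep ε m p σ) (initial n m) s

/-- The algorithm is not blocked in `s`: it can select a node and find a vertex, and whatever it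
selects and finds, it can complete the iteration. -/
def CanProceed {n : ℕ} (ε : ℝ) (m : ℕ) (p : Fin n → ℕ) (σ : Equiv.Perm (Fin n))
    (s : State n m) : Prop :=
  (∃ v x, Selects (globalOpt m p) (normalized m p σ) s v x) ∧
  ∀ v x, Selects (globalOpt m p) (normalized m p σ) s v x →
    ∃ s', Processes ε (globalOpt m p) (normalized m p σ) s v x s'

/-- The algorithm stops in `s` and returns the schedule `R` of the jobs in their original order. -/
def Returns {n m : ℕ} (σ : Equiv.Perm (Fin n)) (s : State n m) (R : Fin n → Fin m) : Prop :=
  s.halted = true ∧ ∃ B, s.best = some B ∧ R = fun j => B (σ.symm j)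

end EqProf

/-! Measure time in units of `T₀`. Then every job has length at most 1, the total length is at most
`m`, and all lower bounds are at least 1 (if `T₀ = 0`, all lengths vanish). Let `c` be the optimal
makespan in these units; rounding a vertex at the root shows `c ≤ 2`.

No blocking: a vertex has at most as many support edges on its fractional jobs as there are
constraints touching them, while each fractional job has two edges, so Hall's theorem gives the
matching. If the longest job `j` is integral at a vertex that has a fractional job,
`exists_vertex_fractional` makes `j` fractional, by exchanging part of `j` against a fractional job
or by maximizing the share of `j` on a suitable machine over a face.

Approximation: if the longest unfixed job has length at most `ε`, rounding at the selected node `v`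
loses at most `ε ≤ ε * LB(v)`, and the stopping criterion holds. So while the algorithm runs, the
tree fixes only jobs longer than `ε`, and profiles see all fixed jobs. Call a node good (`Good`) if
its subtree contains a schedule of makespan at most `c` once the long jobs, and only those, are
rounded down. The root is good, and equivalent nodes of equal depth are equally good, by permuting
machines (`Good.of_equivalent`). Since goodness refers to rounded lengths throughout, no error
accumulates when nodes replace one another; undoing the rounding costs one factor `1 + ε`. Hence a
deepest good node of the tree is active, with lower bound at most `(1 + ε) * c`, unless a schedule
that good is already known (`Invariant.exists_good`). The stopping criterion costs the second
factor.

Counting: at most `m / ε` jobs are longer than `ε`, and the rounded loads lie in a finite set `V`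
depending on `ε` alone (`exists_finset_load`). So there are at most `(m / ε + 1) * (m + 1) ^ #V`
pairs of a depth and a profile, and each occurs at most once in the tree. -/

namespace EqProf

open Finset

/-! ### Vertices of the relaxation: supports and matchings -/

section Relaxation

variable {n m : ℕ} {J : Finset (Fin n)} {q : Fin n → ℝ} {t : Fin m → ℝ} {T : ℝ}
  {x : Fin n → Fin m → ℝ}

theorem le_one_of_mem_partialLP (hx : x ∈ partialLP J q t T) (j : Fin n) (i : Fin m) : x j i ≤ 1 := by
  by_cases hj : j ∈ J
  · rw [← hx.1 j hj]
    exact single_le_sum (fun i _ => hx.2.2.1 j i) (mem_univ i)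
  · rw [hx.2.2.2 j i (Or.inl hj)]
    exact zero_le_one

theorem isCompact_partialLP : IsCompact (partialLP J q t T) := by
  have hc : IsClosed (partialLP J q t T) := by
    have : partialLP J q t T = (⋂ j ∈ J, {x | ∑ i, x j i = 1}) ∩
        ((⋂ i, {x | ∑ j ∈ J, q j * x j i ≤ T - t i}) ∩ ((⋂ j, ⋂ i, {x | 0 ≤ x j i}) ∩
          ⋂ j, ⋂ i, ⋂ _ : j ∉ J ∨ T < q j, {x | x j i = 0})) := by
      ext x
      simp only [partialLP, Set.mem_inter_iff, Set.mem_iInter]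
      rfl
    rw [this]
    refine IsClosed.inter ?_ (IsClosed.inter ?_ (IsClosed.inter ?_ ?_))
    · exact isClosed_iInter fun j => isClosed_iInter fun _ =>
        isClosed_eq (by fun_prop) continuous_const
    · exact isClosed_iInter fun i => isClosed_le (by fun_prop) continuous_const
    · exact isClosed_iInter fun j => isClosed_iInter fun i =>
        isClosed_le continuous_const (by fun_prop)
    · exact isClosed_iInter fun j => isClosed_iInter fun i => isClosed_iInter fun _ =>
        isClosed_eq (by fun_prop) continuous_const
  exact (isCompact_Icc (a := (0 : Fin n → Fin m → ℝ)) (b := 1)).of_isClosed_subset hc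
    fun x hx => ⟨fun j i => hx.2.2.1 j i, fun j i => le_one_of_mem_partialLP hx j i⟩

/-- A vertex admits no perturbation inside its support that keeps the tight constraints. -/
theorem eq_zero_of_perturbation (hx : x ∈ (partialLP J q t T).extremePoints ℝ)
    {d : Fin n → Fin m → ℝ} (hsupp : ∀ j i, x j i = 0 → d j i = 0)
    (hrow : ∀ j ∈ J, ∑ i, d j i = 0)
    (hcol : ∀ i, ∑ j ∈ J, q j * x j i = T - t i → ∑ j ∈ J, q j * d j i = 0) : d = 0 := by
  have hP := hx.1
  have key : ∀ᶠ δ : ℝ in nhds 0, x + δ • d ∈ partialLP J q t T := by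
    have h1 : ∀ᶠ δ : ℝ in nhds 0, ∀ j i, 0 ≤ x j i + δ * d j i := by
      refine Filter.eventually_all.2 fun j => Filter.eventually_all.2 fun i => ?_
      rcases (hP.2.2.1 j i).eq_or_lt with h | h
      · simp [← h, hsupp j i h.symm]
      · have hc : ContinuousAt (fun δ : ℝ => x j i + δ * d j i) 0 := by fun_prop
        have := continuousAt_const.eventually_lt hc (by simpa using h)
        exact this.mono fun _ h => h.le
    have h2 : ∀ᶠ δ : ℝ in nhds 0, ∀ i,
        ∑ j ∈ J, q j * x j i + δ * ∑ j ∈ J, q j * d j i ≤ T - t i := by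
      refine Filter.eventually_all.2 fun i => ?_
      rcases (hP.2.1 i).eq_or_lt with h | h
      · simp [h, hcol i h]
      · have hc : ContinuousAt
            (fun δ : ℝ => ∑ j ∈ J, q j * x j i + δ * ∑ j ∈ J, q j * d j i) 0 := by fun_prop
        have := hc.eventually_lt continuousAt_const (by simpa using h)
        exact this.mono fun _ h => h.le
    filter_upwards [h1, h2] with δ h1 h2
    refine ⟨fun j hj => ?_, fun i => ?_, fun j i => ?_, fun j i h => ?_⟩
    · simp [sum_add_distrib, ← mul_sum, hrow j hj, hP.1 j hj]
    · refine le_trans (le_of_eq ?_) (h2 i)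
      rw [mul_sum, ← sum_add_distrib]
      refine sum_congr rfl fun j _ => ?_
      simp only [Pi.add_apply, Pi.smul_apply, smul_eq_mul]
      ring
    · simpa using h1 j i
    · have h0 := hP.2.2.2 j i h
      simp [h0, hsupp j i h0]
  have key' : ∀ᶠ δ : ℝ in nhds 0, x + (-δ) • d ∈ partialLP J q t T := by
    have : Filter.Tendsto (fun δ : ℝ => -δ) (nhds 0) (nhds 0) := by
      simpa using (continuous_neg (G := ℝ)).tendsto 0
    exact this.eventually key
  obtain ⟨δ, ⟨h1, h2⟩, hδ⟩ :=
    (((key.and key').filter_mono nhdsWithin_le_nhds).and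
      (self_mem_nhdsWithin (a := (0 : ℝ)) (s := Set.Ioi 0))).exists
  have hseg : x ∈ openSegment ℝ (x + δ • d) (x + (-δ) • d) :=
    ⟨1 / 2, 1 / 2, by norm_num, by norm_num, by norm_num, by
      ext j i
      simp only [Pi.add_apply, Pi.smul_apply, smul_eq_mul]
      ring⟩
  have := hx.2 h1 h2 hseg
  have h3 : δ • d = 0 := by simpa using this
  exact (smul_eq_zero.1 h3).resolve_left (ne_of_gt hδ)

/-- The number of edges in the support of a vertex is bounded by the number of constraints. -/
theorem card_edges_le (hx : x ∈ (partialLP J q t T).extremePoints ℝ)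
    {E : Finset (Fin n × Fin m)} {A : Finset (Fin n)} {C : Finset (Fin m)}
    (hE : ∀ e ∈ E, x e.1 e.2 ≠ 0) (hA : ∀ e ∈ E, e.1 ∈ A)
    (hC : ∀ d : Fin n → Fin m → ℝ, (∀ j i, (j, i) ∉ E → d j i = 0) →
      (∀ j, ∑ i, d j i = 0) → (∀ i ∈ C, ∑ j ∈ J, q j * d j i = 0) →
      ∀ i, ∑ j ∈ J, q j * x j i = T - t i → ∑ j ∈ J, q j * d j i = 0) :
    #E ≤ #A + #C := by
  let ext : (E → ℝ) →ₗ[ℝ] (Fin n × Fin m → ℝ) :=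
    Function.ExtendByZero.linearMap ℝ (Subtype.val : E → Fin n × Fin m)
  let con : (Fin n × Fin m → ℝ) →ₗ[ℝ] (A → ℝ) × (C → ℝ) :=
    (LinearMap.pi fun k : A => ∑ i, LinearMap.proj (k.1, i)).prod
      (LinearMap.pi fun i : C => ∑ j ∈ J, q j • LinearMap.proj (j, i.1))
  have hext : ∀ f : E → ℝ, ∀ e (he : e ∈ E), ext f e = f ⟨e, he⟩ := fun f e he =>
    Subtype.val_injective.extend_apply f 0 ⟨e, he⟩
  have hext0 : ∀ f : E → ℝ, ∀ e, e ∉ E → ext f e = 0 := fun f e he =>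
    Function.extend_apply' (f := (Subtype.val : E → Fin n × Fin m)) f 0 e
      (by rintro ⟨a, rfl⟩; exact he a.2)
  -- A kernel element has zero row sums and zero load on `C`, hence on all tight machines by `hC`,
  -- so it is a forbidden perturbation.
  have hinj : Function.Injective (con ∘ₗ ext) := by
    rw [← LinearMap.ker_eq_bot, LinearMap.ker_eq_bot']
    intro f hf
    have hf1 : ∀ j ∈ A, ∑ i, ext f (j, i) = 0 := fun j hj => by
      have := congrFun (congrArg Prod.fst hf) ⟨j, hj⟩
      simpa [con] using this
    have hf2 : ∀ i ∈ C, ∑ j ∈ J, q j * ext f (j, i) = 0 := fun i hi => by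
      have := congrFun (congrArg Prod.snd hf) ⟨i, hi⟩
      simpa [con] using this
    have hrow : ∀ j, ∑ i, ext f (j, i) = 0 := fun j => by
      by_cases hj : j ∈ A
      · exact hf1 j hj
      · exact sum_eq_zero fun i _ => hext0 f _ fun h => hj (hA _ h)
    have hd := eq_zero_of_perturbation hx (d := fun j i => ext f (j, i))
      (fun j i h => hext0 f _ fun he => hE _ he h) (fun j _ => hrow j)
      (hC _ (fun j i h => hext0 f _ h) hrow hf2)
    ext e
    rw [← hext f e.1 e.2]
    exact congrFun (congrFun hd e.1.1) e.1.2
  have := LinearMap.finrank_le_finrank_of_injective hinj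
  simpa using this

theorem Fractional.mem (hx : x ∈ partialLP J q t T) {j : Fin n} (hj : Fractional x j) :
    j ∈ J := by
  obtain ⟨i, h, -⟩ := hj
  by_contra hJ
  exact h (hx.2.2.2 j i (Or.inl hJ))

theorem exists_eq_one (hx : x ∈ partialLP J q t T) {j : Fin n} (hJ : j ∈ J)
    (hj : ¬ Fractional x j) : ∃ i, x j i = 1 := by
  by_contra! h
  refine zero_ne_one (α := ℝ) ?_
  rw [← hx.1 j hJ]
  refine (sum_eq_zero fun i _ => ?_).symm
  by_contra h0
  exact hj ⟨i, h0, h i⟩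

theorem eq_zero_of_eq_one (hx : x ∈ partialLP J q t T) {j : Fin n} {a i : Fin m}
    (ha : x j a = 1) (hi : i ≠ a) : x j i = 0 := by
  have hJ : j ∈ J := by
    by_contra hJ
    rw [hx.2.2.2 j a (Or.inl hJ)] at ha
    exact zero_ne_one ha
  have h1 := hx.1 j hJ
  have h2 : x j i + x j a ≤ ∑ i, x j i := by
    rw [← sum_pair hi]
    exact sum_le_sum_of_subset_of_nonneg (subset_univ _) fun k _ _ => hx.2.2.1 j k
  have := hx.2.2.1 j i
  linarith

theorem not_fractional_of_eq_one (hx : x ∈ partialLP J q t T) {j : Fin n} {a : Fin m}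
    (ha : x j a = 1) : ¬ Fractional x j := by
  rintro ⟨i, h0, h1⟩
  by_cases h : i = a
  · exact h1 (h ▸ ha)
  · exact h0 (eq_zero_of_eq_one hx ha h)

theorem Fractional.exists_other (hx : x ∈ partialLP J q t T) {j : Fin n} (hj : Fractional x j)
    (a : Fin m) : ∃ b ≠ a, x j b ≠ 0 := by
  by_contra! h
  have h1 := hx.1 j (hj.mem hx)
  rw [sum_eq_single a (fun b _ hb => h b hb) (by simp)] at h1
  exact not_fractional_of_eq_one hx h1 hj

theorem Fractional.lt_one (hx : x ∈ partialLP J q t T) {j : Fin n} (hj : Fractional x j)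
    (a : Fin m) : x j a < 1 :=
  lt_of_le_of_ne (le_one_of_mem_partialLP hx j a) fun h => not_fractional_of_eq_one hx h hj

theorem Fractional.two_le_card (hx : x ∈ partialLP J q t T) {j : Fin n} (hj : Fractional x j) :
    2 ≤ #{i | x j i ≠ 0} := by
  obtain ⟨a, ha, -⟩ := id hj
  obtain ⟨b, hb, hb0⟩ := hj.exists_other hx a
  exact one_lt_card.2 ⟨a, by simpa using ha, b, by simpa using hb0, hb.symm⟩

/-- A job of length 0 could shift between two machines of its support without changing any load,
which a vertex forbids. -/
theorem Fractional.pos (hx : x ∈ (partialLP J q t T).extremePoints ℝ) (hq : ∀ j, 0 ≤ q j)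
    {k : Fin n} (hk : Fractional x k) : 0 < q k := by
  refine lt_of_le_of_ne (hq k) fun h0 => ?_
  obtain ⟨a, ha, -⟩ := id hk
  obtain ⟨b, hb, hb0⟩ := hk.exists_other hx.1 a
  have := eq_zero_of_perturbation hx
    (d := fun j i => if j = k then (if i = a then 1 else 0) - (if i = b then 1 else 0) else 0)
    (fun j i h => by
      by_cases hj : j = k
      · subst hj
        have h1 : i ≠ a := fun h' => ha (h' ▸ h)
        have h2 : i ≠ b := fun h' => hb0 (h' ▸ h)
        simp [h1, h2]
      · simp [hj])
    (fun j _ => by by_cases hj : j = k <;> simp [hj])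
    (fun i _ => sum_eq_zero fun j _ => by by_cases hj : j = k <;> simp [hj, ← h0])
  have := congrFun (congrFun this k) a
  simp [hb.symm] at this

/-- The fractional jobs of a vertex can be matched injectively to machines in their support. -/
theorem exists_matching (hx : x ∈ (partialLP J q t T).extremePoints ℝ) :
    ∃ f : {j // Fractional x j} → Fin m, Function.Injective f ∧ ∀ j, x j.1 (f j) ≠ 0 := by
  classical
  have := (all_card_le_biUnion_card_iff_exists_injective
    (fun j : {j // Fractional x j} => ({i | x j.1 i ≠ 0} : Finset (Fin m)))).1 ?_
  · simpa using this
  intro s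
  set A : Finset (Fin n) := s.map (Function.Embedding.subtype _) with hA
  set E : Finset (Fin n × Fin m) := {e | e.1 ∈ A ∧ x e.1 e.2 ≠ 0} with hE
  -- Hall's condition: `E` consists of the edges at `s`, which only load the neighbourhood of `s`.
  -- As each job has two edges, `2 * #A ≤ #E ≤ #A + #N(s)`.
  have h1 : #E ≤ #A + #(s.biUnion fun j => ({i | x j.1 i ≠ 0} : Finset (Fin m))) := by
    refine card_edges_le hx (fun e he => (mem_filter.1 he).2.2) (fun e he => (mem_filter.1 he).2.1)
      fun d hd _ hC i _ => ?_
    by_cases hi : i ∈ s.biUnion fun j => ({i | x j.1 i ≠ 0} : Finset (Fin m))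
    · exact hC i hi
    · refine sum_eq_zero fun j _ => ?_
      rw [hd j i, mul_zero]
      intro he
      obtain ⟨hjA, h0⟩ := (mem_filter.1 he).2
      obtain ⟨j', hj', rfl⟩ := mem_map.1 hjA
      exact hi (mem_biUnion.2 ⟨j', hj', by simpa using h0⟩)
  have h2 : 2 * #A ≤ #E := by
    rw [card_eq_sum_card_fiberwise (f := Prod.fst) (t := A)
      (fun e he => (mem_filter.1 he).2.1), mul_comm, ← smul_eq_mul]
    refine card_nsmul_le_sum _ _ _ fun j hj => ?_
    obtain ⟨j', hj', rfl⟩ := mem_map.1 hj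
    refine (j'.2.two_le_card hx.1).trans ?_
    refine card_le_card_of_injOn (fun i => (j'.1, i)) (fun i hi => ?_) (by simp [Set.InjOn])
    rw [mem_coe, mem_filter] at hi ⊢
    exact ⟨mem_filter.2 ⟨mem_univ _, hj, hi.2⟩, rfl⟩
  have h3 : #A = #s := card_map _
  omega

end Relaxation

/-! ### Vertices in which the longest job is fractional -/

section Relaxation

variable {n m : ℕ} {J : Finset (Fin n)} {q : Fin n → ℝ} {t : Fin m → ℝ} {T : ℝ}
  {x : Fin n → Fin m → ℝ}

/-- If a vertex has a fractional job, then some tight machine processes a part of exactly one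
fractional job. -/
theorem exists_tight_leaf (hx : x ∈ (partialLP J q t T).extremePoints ℝ) {k₀ : Fin n}
    (hk₀ : Fractional x k₀) :
    ∃ b k, ∑ j ∈ J, q j * x j b = T - t b ∧ Fractional x k ∧ x k b ≠ 0 ∧
      ∀ l, Fractional x l → x l b ≠ 0 → l = k := by
  classical
  by_contra! hno
  set A : Finset (Fin n) := {k | Fractional x k} with hA
  set E : Finset (Fin n × Fin m) := {e | Fractional x e.1 ∧ x e.1 e.2 ≠ 0} with hE
  set M : Finset (Fin m) := E.image Prod.snd with hM
  set M₁ : Finset (Fin m) := {i ∈ M | ∑ j ∈ J, q j * x j i = T - t i} with hM₁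
  set M₂ : Finset (Fin m) := {i ∈ M | ¬ ∑ j ∈ J, q j * x j i = T - t i} with hM₂
  have hM12 : #M₁ + #M₂ = #M := card_filter_add_card_filter_not _
  have hmemE : ∀ j i, (j, i) ∈ E ↔ Fractional x j ∧ x j i ≠ 0 := fun j i => by simp [hE]
  have hEA : 2 * #A ≤ #E := by
    rw [card_eq_sum_card_fiberwise (f := Prod.fst) (t := A)
      (fun e he => by simpa [hA] using ((hmemE e.1 e.2).1 he).1), mul_comm, ← smul_eq_mul]
    refine card_nsmul_le_sum _ _ _ fun j hj => ?_
    have hj' : Fractional x j := by simpa [hA] using hj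
    refine (hj'.two_le_card hx.1).trans ?_
    refine card_le_card_of_injOn (fun i => (j, i)) (fun i hi => ?_) (by simp [Set.InjOn])
    rw [mem_coe, mem_filter] at hi ⊢
    exact ⟨(hmemE _ _).2 ⟨hj', hi.2⟩, rfl⟩
  -- By `hno` a tight machine that meets a fractional job meets a second one. Averaging with `hEA`
  -- gives `#E ≥ #A + #M₁ + #M₂ / 2`.
  have hEM : 2 * #M₁ + #M₂ ≤ #E := by
    have h1 : ∀ i ∈ M₁, 2 ≤ #{e ∈ E | e.2 = i} := fun i hi => by
      obtain ⟨hiM, ht⟩ := mem_filter.1 hi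
      obtain ⟨e, he, rfl⟩ := mem_image.1 hiM
      obtain ⟨hf, h0⟩ := (hmemE e.1 e.2).1 he
      obtain ⟨l, hl, hl0, hne⟩ := hno e.2 e.1 ht hf h0
      refine one_lt_card.2 ⟨e, mem_filter.2 ⟨he, rfl⟩, (l, e.2),
        mem_filter.2 ⟨(hmemE _ _).2 ⟨hl, hl0⟩, rfl⟩, fun h => hne ?_⟩
      exact (congrArg Prod.fst h).symm
    have h2 : ∀ i ∈ M₂, 1 ≤ #{e ∈ E | e.2 = i} := fun i hi => by
      obtain ⟨e, he, rfl⟩ := mem_image.1 (mem_filter.1 hi).1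
      exact card_pos.2 ⟨e, mem_filter.2 ⟨he, rfl⟩⟩
    rw [card_eq_sum_card_fiberwise (f := Prod.snd) (t := M)
      (fun e he => mem_image_of_mem _ he)]
    have h3 : ∑ i ∈ M₁, #{e ∈ E | e.2 = i} + ∑ i ∈ M₂, #{e ∈ E | e.2 = i} =
        ∑ i ∈ M, #{e ∈ E | e.2 = i} := sum_filter_add_sum_filter_not _ _ _
    have h1' := card_nsmul_le_sum _ _ _ h1
    have h2' := card_nsmul_le_sum _ _ _ h2
    simp only [smul_eq_mul] at h1' h2'
    omega
  have hout : ∀ d : Fin n → Fin m → ℝ, (∀ j i, (j, i) ∉ E → d j i = 0) →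
      ∀ i ∉ M, ∑ j ∈ J, q j * d j i = 0 := fun d hd i hi =>
    sum_eq_zero fun j _ => by
      rw [hd j i fun h => hi (mem_image.2 ⟨_, h, rfl⟩), mul_zero]
  have hE0 : ∀ e ∈ E, x e.1 e.2 ≠ 0 := fun e he => ((hmemE e.1 e.2).1 he).2
  have hE1 : ∀ e ∈ E, e.1 ∈ A := fun e he => by simpa [hA] using ((hmemE e.1 e.2).1 he).1
  -- Slack machines impose no constraint, so `#E ≤ #A + #M₁`, a contradiction if `M₂` is nonempty.
  -- Otherwise one machine constraint is redundant: zero row sums make the loads of `d` add up to 0.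
  rcases M₂.eq_empty_or_nonempty with h0 | h0
  · obtain ⟨i₀, hi₀, -⟩ := id hk₀
    have hi₀M : i₀ ∈ M := mem_image.2 ⟨(k₀, i₀), (hmemE _ _).2 ⟨hk₀, hi₀⟩, rfl⟩
    have := card_edges_le hx (C := M.erase i₀) hE0 hE1 fun d hd hrow hC i _ => by
      have hoth : ∀ i ≠ i₀, ∑ j ∈ J, q j * d j i = 0 := fun i hi => by
        by_cases hiM : i ∈ M
        · exact hC i (mem_erase.2 ⟨hi, hiM⟩)
        · exact hout d hd i hiM
      by_cases hi : i = i₀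
      · have h1 : ∑ i, ∑ j ∈ J, q j * d j i = 0 := by
          rw [sum_comm]
          exact sum_eq_zero fun j _ => by rw [← mul_sum, hrow j, mul_zero]
        rw [sum_eq_single i₀ (fun i _ hi => hoth i hi) (by simp)] at h1
        rw [hi, h1]
      · exact hoth i hi
    rw [card_erase_of_mem hi₀M] at this
    have hpos : 0 < #M := card_pos.2 ⟨_, hi₀M⟩
    rw [h0, card_empty] at hM12 hEM
    omega
  · have := card_edges_le hx (C := M₁) hE0 hE1 fun d hd hrow hC i hi => by
      by_cases hiM : i ∈ M
      · exact hC i (mem_filter.2 ⟨hiM, hi⟩)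
      · exact hout d hd i hiM
    have hpos := h0.card_pos
    omega

/-- The direction in which the part of `k` on `b` moves to `a`, while a fraction `η` of `j` moves
from `a` to `b`. -/
def swapDirection (x : Fin n → Fin m → ℝ) (j k : Fin n) (a b : Fin m) (η : ℝ) (l : Fin n)
    (i : Fin m) : ℝ :=
  (if l = k then (if i = a then x k b else 0) - (if i = b then x k b else 0) else 0) +
    (if l = j then (if i = b then η else 0) - (if i = a then η else 0) else 0)

theorem sum_swapDirection (x : Fin n → Fin m → ℝ) (j k : Fin n) (a b : Fin m) (η : ℝ)
    (l : Fin n) : ∑ i, swapDirection x j k a b η l i = 0 := by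
  by_cases h1 : l = k <;> by_cases h2 : l = j <;> simp [swapDirection, h1, h2, sum_add_distrib]

theorem sum_mul_swapDirection {j k : Fin n} (hj : j ∈ J) (hk : k ∈ J) (a b : Fin m) {η : ℝ}
    (hη : q j * η = q k * x k b) (i : Fin m) :
    ∑ l ∈ J, q l * swapDirection x j k a b η l i = 0 := by
  simp only [swapDirection, mul_add, sum_add_distrib, mul_ite, mul_zero, sum_ite_eq', hj, hk,
    if_true, mul_sub, hη]
  ring

theorem le_limit_of_mem (hx : x ∈ partialLP J q t T) {j : Fin n} (hj : j ∈ J) : q j ≤ T := by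
  by_contra! h
  have := hx.1 j hj
  rw [sum_eq_zero fun i _ => hx.2.2.2 j i (Or.inr h)] at this
  exact zero_ne_one this

/-- Equal amounts of work move both ways, so no load changes. Pruning is respected because `j` and
`k`, being scheduled, have length at most `T`. -/
theorem add_swapDirection_mem (hx : x ∈ partialLP J q t T) {j k : Fin n} (hj : j ∈ J)
    (hk : k ∈ J) (hjk : k ≠ j) {a b : Fin m} (hab : b ≠ a) (ha : x j a = 1) {η : ℝ}
    (hη : q j * η = q k * x k b) (hη0 : 0 ≤ η) (hη1 : η ≤ 1) :
    x + swapDirection x j k a b η ∈ partialLP J q t T := by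
  refine ⟨fun l hl => ?_, fun i => ?_, fun l i => ?_, fun l i h => ?_⟩
  · simp [sum_add_distrib, sum_swapDirection, hx.1 l hl]
  · simp only [Pi.add_apply, mul_add, sum_add_distrib, sum_mul_swapDirection hj hk a b hη i,
      add_zero]
    exact hx.2.1 i
  · have h0 := hx.2.2.1
    have h1 := h0 k b
    have h2 := h0 l i
    simp only [Pi.add_apply, swapDirection]
    by_cases hlk : l = k
    · subst hlk
      by_cases hi : i = a
      · subst hi
        simp only [if_true, hab.symm, if_false, hjk]
        linarith
      · by_cases hb : i = b
        · subst hb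
          simp [hi, hjk]
        · simp [hi, hb, hjk, h2]
    · by_cases hlj : l = j
      · subst hlj
        by_cases hi : i = a
        · subst hi
          simp [hlk, hab.symm, ha, hη1]
        · simp only [hi, hlk, if_false, if_true]
          split_ifs <;> linarith
      · simp [hlk, hlj, h2]
  · rcases h with h | h
    · have h1 : l ≠ k := fun h' => h (h' ▸ hk)
      have h2 : l ≠ j := fun h' => h (h' ▸ hj)
      simp [swapDirection, h1, h2, hx.2.2.2 l i (Or.inl h)]
    · have h1 : l ≠ k := fun h' => (le_limit_of_mem hx hk).not_gt (h' ▸ h)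
      have h2 : l ≠ j := fun h' => (le_limit_of_mem hx hj).not_gt (h' ▸ h)
      simp [swapDirection, h1, h2, hx.2.2.2 l i (Or.inr h)]

/-- The support gains only `(j, b)` and loses `(k, b)`; `hka` ensures that `(k, a)` is not new. For
a deviation `d` from the new point, subtracting the multiple of `D` that cancels `d j b` leaves a
perturbation inside the support of `x`, which is 0. Evaluating at `(k, b)`, where `d` vanishes but
`D` does not, shows that the multiple is 0 too. -/
theorem add_swapDirection_mem_extremePoints (hx : x ∈ (partialLP J q t T).extremePoints ℝ)
    {j k : Fin n} (hj : j ∈ J) (hk : k ∈ J) (hjk : k ≠ j) {a b : Fin m} (hab : b ≠ a)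
    (ha : x j a = 1) (hka : x k a ≠ 0) (hkb : x k b ≠ 0) {η : ℝ}
    (hη : q j * η = q k * x k b) (hη0 : 0 < η) (hη1 : η ≤ 1) :
    x + swapDirection x j k a b η ∈ (partialLP J q t T).extremePoints ℝ := by
  set D := swapDirection x j k a b η with hD
  refine ⟨add_swapDirection_mem hx.1 hj hk hjk hab ha hη hη0.le hη1, ?_⟩
  rintro u hu w hw ⟨α, β, hα, hβ, hαβ, hy⟩
  have hy' : ∀ l i, α * u l i + β * w l i = x l i + D l i := fun l i =>
    congrFun (congrFun hy l) i
  set d : Fin n → Fin m → ℝ := u - (x + D) with hd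
  have hsupp : ∀ l i, x l i + D l i = 0 → d l i = 0 := fun l i h => by
    have h1 := hy' l i
    have h2 := mul_nonneg hα.le (hu.2.2.1 l i)
    have h3 := mul_nonneg hβ.le (hw.2.2.1 l i)
    have h4 : α * u l i = 0 := by linarith
    simpa [hd, h] using (mul_eq_zero.1 h4).resolve_left hα.ne'
  have hDb : D j b = η := by simp [hD, swapDirection, hab, hjk.symm]
  have hDk : D k b = - x k b := by simp [hD, swapDirection, hab, hjk]
  have h0 := eq_zero_of_perturbation hx (d := d - (d j b / η) • D)
    (fun l i h => by
      by_cases hjb : l = j ∧ i = b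
      · obtain ⟨rfl, rfl⟩ := hjb
        simp [hDb, hη0.ne']
      · have hDl : D l i = 0 := by
          have h1 : ¬ (l = k ∧ i = a) := by rintro ⟨rfl, rfl⟩; exact hka h
          have h2 : ¬ (l = k ∧ i = b) := by rintro ⟨rfl, rfl⟩; exact hkb h
          have h3 : ¬ (l = j ∧ i = a) := by
            rintro ⟨rfl, rfl⟩
            exact one_ne_zero (ha.symm.trans h)
          simp only [hD, swapDirection]
          grind
        have := hsupp l i (by rw [h, hDl, add_zero])
        simp [this, hDl])
    (fun l hl => by
      have h1 := hx.1.1 l hl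
      have h2 := hu.1 l hl
      have h3 := sum_swapDirection x j k a b η l
      simp only [Pi.sub_apply, Pi.smul_apply, Pi.add_apply, smul_eq_mul, sum_sub_distrib, hd,
        sum_add_distrib, ← mul_sum, hD, h1, h2, h3]
      ring)
    (fun i hi => by
      have h3 := sum_mul_swapDirection (x := x) hj hk a b hη i
      have h4 : ∑ l ∈ J, q l * u l i = T - t i := by
        have h5 : α * ∑ l ∈ J, q l * u l i + β * ∑ l ∈ J, q l * w l i = T - t i := by
          rw [← hi, ← add_zero (∑ l ∈ J, q l * x l i), ← h3, ← sum_add_distrib, mul_sum, mul_sum,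
            ← sum_add_distrib]
          refine sum_congr rfl fun l _ => ?_
          rw [← mul_add, ← hD, ← hy' l i]
          ring
        have h6 := hu.2.1 i
        have h7 := mul_le_mul_of_nonneg_left (hw.2.1 i) hβ.le
        have h8 : α * (T - t i) ≤ α * ∑ l ∈ J, q l * u l i := by
          have : α * (T - t i) + β * (T - t i) = T - t i := by rw [← add_mul, hαβ, one_mul]
          linarith
        exact le_antisymm h6 (le_of_mul_le_mul_left h8 hα)
      have h9 : ∀ l, q l * (d - (d j b / η) • D) l i =
          q l * u l i - q l * x l i - q l * D l i - (d j b / η) * (q l * D l i) := fun l => by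
        simp only [hd, Pi.sub_apply, Pi.smul_apply, Pi.add_apply, smul_eq_mul]
        ring
      rw [sum_congr rfl fun l _ => h9 l]
      simp only [sum_sub_distrib, ← mul_sum, hD, h3, h4, hi]
      ring)
  have hc : d j b / η = 0 := by
    have h1 := congrFun (congrFun h0 k) b
    have h2 := hsupp k b (by rw [hDk, add_neg_cancel])
    simp only [Pi.sub_apply, Pi.smul_apply, smul_eq_mul, h2, hDk, Pi.zero_apply] at h1
    have h3 : d j b / η * x k b = 0 := by linarith
    exact (mul_eq_zero.1 h3).resolve_right hkb
  rw [hc, zero_smul, sub_zero] at h0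
  exact sub_eq_zero.1 h0

/-- If a vertex has a fractional job, then a longest job is fractional in some vertex. -/
theorem exists_vertex_fractional (hx : x ∈ (partialLP J q t T).extremePoints ℝ)
    (hq : ∀ j, 0 ≤ q j) {k₀ : Fin n} (hk₀ : Fractional x k₀) {j : Fin n} (hj : j ∈ J)
    (hmax : ∀ k ∈ J, q k ≤ q j) :
    ∃ y ∈ (partialLP J q t T).extremePoints ℝ, Fractional y j ∧ (Fractional x j → y = x) := by
  by_cases hxj : Fractional x j
  · exact ⟨x, hx, hxj, fun _ => rfl⟩
  obtain ⟨a, ha⟩ := exists_eq_one hx.1 hj hxj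
  have hη : ∀ k b, Fractional x k → x k b ≠ 0 → ∃ η, q j * η = q k * x k b ∧ 0 < η ∧ η < 1 := by
    intro k b hk hb
    have h1 := hk.pos hx hq
    have h2 := hmax k (hk.mem hx.1)
    have h3 : 0 < x k b := lt_of_le_of_ne (hx.1.2.2.1 k b) (Ne.symm hb)
    have h4 := hk.lt_one hx.1 b
    have h5 : 0 < q j := h1.trans_le h2
    refine ⟨q k * x k b / q j, by field_simp, by positivity, ?_⟩
    rw [div_lt_one h5]
    exact (mul_lt_of_lt_one_right h1 h4).trans_le h2
  have hkj : ∀ k, Fractional x k → k ≠ j := fun k hk h => hxj (h ▸ hk)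
  by_cases hA : ∃ k, Fractional x k ∧ x k a ≠ 0
  · obtain ⟨k, hk, hka⟩ := hA
    obtain ⟨b, hab, hkb⟩ := hk.exists_other hx.1 a
    obtain ⟨η, h1, h2, h3⟩ := hη k b hk hkb
    refine ⟨_, add_swapDirection_mem_extremePoints hx hj (hk.mem hx.1) (hkj k hk) hab ha hka hkb
      h1 h2 h3.le, ⟨b, ?_⟩, fun h => absurd h hxj⟩
    have : (x + swapDirection x j k a b η) j b = η := by
      simp [swapDirection, hab, (hkj k hk).symm, eq_zero_of_eq_one hx.1 ha hab]
    rw [this]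
    exact ⟨h2.ne', h3.ne⟩
  -- Now no fractional job touches the machine `a` of `j`, and the swap gives a feasible point that
  -- need not be a vertex. It only serves to show that `j` can have a positive share on a tight
  -- machine `b` with a single fractional job.
  · push Not at hA
    obtain ⟨b, k, htight, hk, hkb, huniq⟩ := exists_tight_leaf hx hk₀
    have hab : b ≠ a := fun h => hkb (h ▸ hA k hk)
    obtain ⟨η, h1, h2, h3⟩ := hη k b hk hkb
    have hy := add_swapDirection_mem hx.1 hj (hk.mem hx.1) (hkj k hk) hab ha h1 h2.le h3.le
    set y := x + swapDirection x j k a b η with hydef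
    have hxjb : x j b = 0 := eq_zero_of_eq_one hx.1 ha hab
    have hyb : y j b = η := by simp [hydef, swapDirection, hab, (hkj k hk).symm, hxjb]
    -- `H` is the face on which all jobs that `x` puts entirely on `b` stay there, and `G` is the
    -- subface maximizing the share of `j` on `b`. A vertex of `G` is a vertex of the polyhedron.
    set H : Set (Fin n → Fin m → ℝ) := partialLP J q t T ∩ ⋂ l, {z | x l b = 1 → z l b = 1} with hH
    have hHc : IsCompact H := by
      refine isCompact_partialLP.inter_right (isClosed_iInter fun l => ?_)
      by_cases hl : x l b = 1
      · simpa [hl] using isClosed_eq (f := fun z : Fin n → Fin m → ℝ => z l b) (by fun_prop)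
          continuous_const
      · simp [hl]
    have hyH : y ∈ H := by
      refine ⟨hy, Set.mem_iInter.2 fun l hl => ?_⟩
      have hlk : l ≠ k := fun h => not_fractional_of_eq_one hx.1 (h ▸ hl) hk
      have hlj : l ≠ j := fun h => zero_ne_one (hxjb.symm.trans (h ▸ hl))
      simp [hydef, swapDirection, hlk, hlj, hl]
    obtain ⟨z₀, hz₀, hz₀max⟩ := hHc.exists_isMaxOn ⟨y, hyH⟩
      (f := fun z : Fin n → Fin m → ℝ => z j b) (by fun_prop)
    set G : Set (Fin n → Fin m → ℝ) := H ∩ {z | z j b = z₀ j b} with hG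
    have hGc : IsCompact G :=
      hHc.inter_right (isClosed_eq (by fun_prop) continuous_const)
    obtain ⟨z, hz⟩ := hGc.extremePoints_nonempty ⟨z₀, hz₀, rfl⟩
    have hface : ∀ {α β r s c : ℝ}, 0 < α → 0 < β → α + β = 1 → r ≤ c → s ≤ c →
        α * r + β * s = c → r = c ∧ s = c := by
      intro α β r s c hα hβ hαβ hr hs h
      have h1 : α * (c - r) + β * (c - s) = 0 := by
        linear_combination c * hαβ - h
      have h2 := mul_nonneg hα.le (sub_nonneg.2 hr)
      have h3 := mul_nonneg hβ.le (sub_nonneg.2 hs)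
      have h4 := (mul_eq_zero.1 (show α * (c - r) = 0 by linarith)).resolve_left hα.ne'
      have h5 := (mul_eq_zero.1 (show β * (c - s) = 0 by linarith)).resolve_left hβ.ne'
      exact ⟨by linarith, by linarith⟩
    have hzP : z ∈ (partialLP J q t T).extremePoints ℝ := by
      refine ⟨hz.1.1.1, fun u hu w hw huw => ?_⟩
      obtain ⟨α, β, hα, hβ, hαβ, hzz⟩ := id huw
      have hz' : ∀ l i, α * u l i + β * w l i = z l i := fun l i =>
        congrFun (congrFun hzz l) i
      have h5 : ∀ l, x l b = 1 → u l b = 1 ∧ w l b = 1 := fun l hl =>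
        hface hα hβ hαβ (le_one_of_mem_partialLP hu l b) (le_one_of_mem_partialLP hw l b)
          ((hz' l b).trans (Set.mem_iInter.1 hz.1.1.2 l hl))
      have hu' : u ∈ H := ⟨hu, Set.mem_iInter.2 fun l hl => (h5 l hl).1⟩
      have hw' : w ∈ H := ⟨hw, Set.mem_iInter.2 fun l hl => (h5 l hl).2⟩
      have h6 := hface hα hβ hαβ (hz₀max hu') (hz₀max hw') ((hz' j b).trans hz.1.2)
      exact hz.2 ⟨hu', h6.1⟩ ⟨hw', h6.2⟩ huw
    refine ⟨z, hzP, ⟨b, ?_, ?_⟩, fun h => absurd h hxj⟩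
    · have : η ≤ z₀ j b := hyb ▸ hz₀max hyH
      rw [show z j b = z₀ j b from hz.1.2]
      linarith
    -- If all of `j` were on `b`, it would replace the part `q k * x k b < q k ≤ q j` of `k` and
    -- overload `b`, which is already full in `x`.
    · intro hzj
      have hk1 := hk.pos hx hq
      have hs1 : ∑ l ∈ J, q l * x l b = ∑ l ∈ J, q l * (if x l b = 1 then 1 else 0) +
          q k * x k b := by
        rw [← sum_ite_eq_of_mem' J k (fun l => q l * x l b) (hk.mem hx.1), ← sum_add_distrib]
        refine sum_congr rfl fun l hl => ?_
        by_cases h1 : x l b = 1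
        · have hlk : l ≠ k := fun h => not_fractional_of_eq_one hx.1 (h ▸ h1) hk
          simp [h1, hlk]
        · by_cases h0 : x l b = 0
          · simp [h0]
          · simp [huniq l ⟨b, h0, h1⟩ h0, (hk.lt_one hx.1 b).ne]
      have hs2 : ∑ l ∈ J, q l * (if x l b = 1 then 1 else 0) + q j ≤ ∑ l ∈ J, q l * z l b := by
        rw [← sum_ite_eq_of_mem' J j q hj, ← sum_add_distrib]
        refine sum_le_sum fun l hl => ?_
        have hzl := mul_nonneg (hq l) (hz.1.1.1.2.2.1 l b)
        by_cases hlj : l = j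
        · subst hlj
          simp [hxjb, hzj]
        · by_cases h1 : x l b = 1
          · have : z l b = 1 := Set.mem_iInter.1 hz.1.1.2 l h1
            simp [h1, hlj, this]
          · simp [h1, hlj, hzl]
      have hs3 := hz.1.1.1.2.1 b
      have hs4 := mul_lt_of_lt_one_right hk1 (hk.lt_one hx.1 b)
      have hs5 := hmax k (hk.mem hx.1)
      linarith

end Relaxation

/-! ### Rounding a vertex to a schedule -/

section Rounding

variable {n m : ℕ} {q : Fin n → ℝ} {t : Fin m → ℝ} {T : ℝ} {v : Node n m}
  {x : Fin n → Fin m → ℝ}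

theorem exists_isRounding (hx : x ∈ (partialLP (unfixed v) q t T).extremePoints ℝ) :
    ∃ S, IsRounding v x S := by
  classical
  obtain ⟨f, hf, hf0⟩ := exists_matching hx
  have hint : ∀ j, ∃ i, (∀ i', v j = some i' → i = i') ∧
      (j ∈ unfixed v → ¬ Fractional x j → x j i = 1) ∧
      (∀ h : Fractional x j, i = f ⟨j, h⟩) := by
    intro j
    by_cases hj : j ∈ unfixed v
    · have hv : v j = none := by simpa [unfixed] using hj
      by_cases hfr : Fractional x j
      · exact ⟨f ⟨j, hfr⟩, by simp [hv], fun _ h => absurd hfr h, fun _ => rfl⟩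
      · obtain ⟨i, hi⟩ := exists_eq_one hx.1 hj hfr
        exact ⟨i, by simp [hv], fun _ _ => hi, fun h => absurd h hfr⟩
    · obtain ⟨i, hi⟩ := Option.ne_none_iff_exists'.1 (show v j ≠ none by simpa [unfixed] using hj)
      exact ⟨i, fun i' h => Option.some_injective _ (hi.symm.trans h), fun h => absurd h hj,
        fun h => absurd (h.mem hx.1) hj⟩
  choose S hS1 hS2 hS3 using hint
  refine ⟨S, fun j i h => hS1 j i h, fun j hj h => hS2 j hj h, fun j h => ?_, ?_⟩
  · rw [hS3 j h]
    exact hf0 ⟨j, h⟩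
  · intro j hj k hk h
    rw [hS3 j hj, hS3 k hk] at h
    exact congrArg Subtype.val (hf h)

/-- The fixed and integral jobs on `i` fit into the limit `T`, and injectivity adds at most one
fractional job. -/
theorem IsRounding.completion_le {S : Fin n → Fin m} (hS : IsRounding v x S)
    (hx : x ∈ partialLP (unfixed v) q (overhead q v) T) (hq : ∀ j, 0 ≤ q j) {β : ℝ} (hβ : 0 ≤ β)
    (hfrac : ∀ j, Fractional x j → q j ≤ β) (i : Fin m) : completion q S i ≤ T + β := by
  classical
  have h1 : ∑ j with Fractional x j ∧ S j = i, q j ≤ β := by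
    refine (sum_le_card_nsmul _ _ β fun j hj => hfrac j (mem_filter.1 hj).2.1).trans ?_
    rw [nsmul_eq_mul]
    refine mul_le_of_le_one_left hβ ?_
    rw [Nat.cast_le_one, card_le_one]
    intro j hj k hk
    rw [mem_filter] at hj hk
    exact hS.2.2.2 hj.2.1 hk.2.1 (hj.2.2.trans hk.2.2.symm)
  have h2 : completion q S i ≤ overhead q v i + ∑ j ∈ unfixed v, q j * x j i +
      ∑ j with Fractional x j ∧ S j = i, q j := by
    simp only [completion, overhead, unfixed, sum_filter, ← sum_add_distrib]
    refine sum_le_sum fun j _ => ?_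
    have h0 := mul_nonneg (hq j) (hx.2.2.1 j i)
    have hqj := hq j
    by_cases hSj : S j = i
    · rcases hv : v j with _ | i'
      · by_cases hf : Fractional x j
        · simp [hSj, hf, h0]
        · have := hS.2.1 j (by simp [unfixed, hv]) hf
          rw [hSj] at this
          simp [hSj, hf, this]
      · have hi' : i' = i := (hS.1 j i' hv).symm.trans hSj
        by_cases hf : Fractional x j <;> simp [hSj, hf, hi', hqj]
    · simp only [hSj, and_false, if_false, add_zero]
      exact add_nonneg (by split_ifs <;> simp [hqj]) (by split_ifs <;> simp [h0])
  have h3 := hx.2.1 i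
  linarith

end Rounding

/-! ### Makespans: monotonicity, scaling, permutation -/

section Schedules

variable {n m : ℕ} {q : Fin n → ℝ}

theorem completion_le_makespan (q : Fin n → ℝ) (S : Fin n → Fin m) (i : Fin m) :
    completion q S i ≤ makespan q S :=
  le_ciSup (f := fun i => completion q S i) (Set.finite_range _).bddAbove i

theorem makespan_le (hm : 1 ≤ m) {S : Fin n → Fin m} {c : ℝ} (h : ∀ i, completion q S i ≤ c) :
    makespan q S ≤ c :=
  have : Nonempty (Fin m) := ⟨⟨0, hm⟩⟩
  ciSup_le h

theorem completion_nonneg (hq : ∀ j, 0 ≤ q j) (S : Fin n → Fin m) (i : Fin m) :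
    0 ≤ completion q S i := sum_nonneg fun j _ => hq j

theorem makespan_nonneg (hm : 1 ≤ m) (hq : ∀ j, 0 ≤ q j) (S : Fin n → Fin m) :
    0 ≤ makespan q S :=
  (completion_nonneg hq S ⟨0, hm⟩).trans (completion_le_makespan q S _)

theorem completion_mono {r : Fin n → ℝ} (h : ∀ j, r j ≤ q j) (S : Fin n → Fin m) (i : Fin m) :
    completion r S i ≤ completion q S i := sum_le_sum fun j _ => h j

theorem completion_const_mul (c : ℝ) (S : Fin n → Fin m) (i : Fin m) :
    completion (fun j => c * q j) S i = c * completion q S i := by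
  simp [completion, mul_sum]

theorem makespan_mono (hm : 1 ≤ m) {r : Fin n → ℝ} (h : ∀ j, r j ≤ q j) (S : Fin n → Fin m) :
    makespan r S ≤ makespan q S :=
  makespan_le hm fun i => (completion_mono h S i).trans (completion_le_makespan q S i)

theorem makespan_const_mul {c : ℝ} (hc : 0 ≤ c) (S : Fin n → Fin m) :
    makespan (fun j => c * q j) S = c * makespan q S := by
  simp only [makespan, completion_const_mul, Real.mul_iSup_of_nonneg hc]

theorem completion_comp_perm (S : Fin n → Fin m) (σ : Equiv.Perm (Fin n)) (i : Fin m) :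
    completion (fun j => q (σ j)) (fun j => S (σ j)) i = completion q S i := by
  simp only [completion, sum_filter]
  exact Equiv.sum_comp σ fun j => if S j = i then q j else 0

theorem makespan_comp_perm (S : Fin n → Fin m) (σ : Equiv.Perm (Fin n)) :
    makespan (fun j => q (σ j)) (fun j => S (σ j)) = makespan q S := by
  simp only [makespan, completion_comp_perm]

end Schedules

/-! ### Subtrees and feasibility -/

section Nodes

variable {n m : ℕ} {q : Fin n → ℝ}

/-- The node `u` lies in the subtree of `v`: everything fixed at `v` is fixed at `u`. -/
def Refines (u v : Node n m) : Prop := ∀ j, v j ≠ none → u j = v j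

/-- The schedule `S` respects what is fixed at `v`. -/
def Extends (S : Fin n → Fin m) (v : Node n m) : Prop := ∀ j i, v j = some i → S j = i

theorem Extends.refines {S : Fin n → Fin m} {v : Node n m} (h : Extends S v) :
    Refines (fun j => some (S j)) v := fun j hj => by
  obtain ⟨i, hi⟩ := Option.ne_none_iff_exists'.1 hj
  rw [hi]
  exact congrArg some (h j i hi)

theorem exists_extends (hm : 1 ≤ m) (v : Node n m) : ∃ S, Extends S v :=
  ⟨fun j => (v j).getD ⟨0, hm⟩, fun j i h => by simp [h]⟩

theorem overhead_le_completion (hq : ∀ j, 0 ≤ q j) {S : Fin n → Fin m} {v : Node n m}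
    (h : Extends S v) (i : Fin m) : overhead q v i ≤ completion q S i :=
  sum_le_sum_of_subset_of_nonneg
    (fun j hj => by
      rw [mem_filter] at hj ⊢
      exact ⟨hj.1, h j i hj.2⟩)
    fun j _ _ => hq j

/-- Jobs fixed only at `u` become integral jobs at `v`. They survive the pruning since each is part
of an overhead of `u`, and these overheads are at most `T`. -/
theorem nonempty_partialLP_of_refines (hq : ∀ j, 0 ≤ q j) {u v : Node n m} (huv : Refines u v)
    {T : ℝ} (h : (partialLP (unfixed u) q (overhead q u) T).Nonempty) :
    (partialLP (unfixed v) q (overhead q v) T).Nonempty := by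
  obtain ⟨x, hx⟩ := h
  have hmemu : ∀ j, j ∈ unfixed u ↔ u j = none := by simp [unfixed]
  have hmemv : ∀ j, j ∈ unfixed v ↔ v j = none := by simp [unfixed]
  have hov : ∀ i, overhead q u i ≤ T := fun i => by
    have h1 := hx.2.1 i
    have h2 : 0 ≤ ∑ j ∈ unfixed u, q j * x j i :=
      sum_nonneg fun j _ => mul_nonneg (hq j) (hx.2.2.1 j i)
    linarith
  refine ⟨fun j i => if v j = none then (if u j = none then x j i else
    if u j = some i then 1 else 0) else 0, fun j hj => ?_, fun i => ?_, fun j i => ?_,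
    fun j i h => ?_⟩
  · rw [hmemv] at hj
    rcases huj : u j with _ | i
    · simpa [hj, huj] using hx.1 j ((hmemu j).2 huj)
    · simp [hj, huj]
  · have h1 : ∑ j ∈ unfixed v, q j * (if v j = none then (if u j = none then x j i else
        if u j = some i then 1 else 0) else 0) + overhead q v i =
        ∑ j ∈ unfixed u, q j * x j i + overhead q u i := by
      simp only [overhead, unfixed, sum_filter, ← sum_add_distrib]
      refine sum_congr rfl fun j _ => ?_
      by_cases hv : v j = none
      · by_cases hu : u j = none <;> simp [hv, hu]
      · simp [hv, huv j hv]
    have h2 := hx.2.1 i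
    simp only at h1 ⊢
    linarith
  · dsimp only
    split_ifs
    exacts [hx.2.2.1 j i, zero_le_one, le_rfl, le_rfl]
  · rcases h with h | h
    · simp [show v j ≠ none from fun h' => h ((hmemv j).2 h')]
    · have h1 := hx.2.2.2 j i (Or.inr h)
      have h2 : u j ≠ some i := fun h' => by
        have h3 : q j ≤ overhead q u i :=
          single_le_sum (f := q) (fun j _ => hq j) (mem_filter.2 ⟨mem_univ _, h'⟩)
        exact (h3.trans (hov i)).not_gt h
      simp [h1, h2]

theorem nonempty_partialLP_of_completion_le (hq : ∀ j, 0 ≤ q j) {v : Node n m}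
    {S : Fin n → Fin m} (hS : Extends S v) {T : ℝ} (h : ∀ i, completion q S i ≤ T) :
    (partialLP (unfixed v) q (overhead q v) T).Nonempty := by
  refine nonempty_partialLP_of_refines hq hS.refines ⟨0, ?_, fun i => ?_, fun j i => le_rfl,
    fun j i _ => rfl⟩
  · simp [unfixed]
  · have : overhead q (fun j => some (S j)) i = completion q S i := by
      simp [overhead, completion]
    simp [this, h i]

end Nodes

/-! ### Lower bounds and normalization by the global fractional optimum -/

section LowerBound

variable {n m : ℕ} {q : Fin n → ℝ} {T₀ : ℕ}

/-- What the algorithm uses about the processing times `q`, measured in units of the global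
fractional optimum `T₀`. -/
structure Scaled (m T₀ : ℕ) (q : Fin n → ℝ) : Prop where
  anti : Antitone q
  grid : ∃ a : Fin n → ℕ, ∀ j, q j = a j / T₀
  le_one : ∀ j, q j ≤ 1
  sum_le : ∑ j, q j ≤ m
  root_le : lowerBound T₀ q (fun _ => none : Node n m) ≤ 1
  one_le : T₀ ≠ 0 → ∀ v : Node n m, 1 ≤ lowerBound T₀ q v

theorem lowerBound_zero (q : Fin n → ℝ) (v : Node n m) : lowerBound 0 q v = 0 := by
  simp [lowerBound]

theorem nonneg_of_grid (hgrid : ∃ a : Fin n → ℕ, ∀ j, q j = a j / T₀) (j : Fin n) : 0 ≤ q j := by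
  obtain ⟨a, ha⟩ := hgrid
  rw [ha]
  positivity

theorem eq_zero_of_grid (hgrid : ∃ a : Fin n → ℕ, ∀ j, q j = a j / T₀) (h : T₀ = 0) (j : Fin n) :
    q j = 0 := by
  obtain ⟨a, ha⟩ := hgrid
  simp [ha, h]

theorem exists_completion_eq (hgrid : ∃ a : Fin n → ℕ, ∀ j, q j = a j / T₀) (S : Fin n → Fin m)
    (i : Fin m) : ∃ k : ℕ, completion q S i = k / T₀ := by
  obtain ⟨a, ha⟩ := hgrid
  exact ⟨∑ j with S j = i, a j, by simp [completion, ha, sum_div]⟩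

theorem lowerBound_le {v : Node n m} {k : ℕ}
    (h : (partialLP (unfixed v) q (overhead q v) ((k : ℝ) / (T₀ : ℝ))).Nonempty) :
    lowerBound T₀ q v ≤ k / T₀ := by
  unfold lowerBound
  gcongr
  exact Nat.sInf_le h

/-- The lower bound of a node is at most the makespan of each schedule in its subtree. -/
theorem lowerBound_le_makespan (hm : 1 ≤ m) (hgrid : ∃ a : Fin n → ℕ, ∀ j, q j = a j / T₀)
    {v : Node n m} {S : Fin n → Fin m} (hS : Extends S v) :
    lowerBound T₀ q v ≤ makespan q S := by
  have : Nonempty (Fin m) := ⟨⟨0, hm⟩⟩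
  obtain ⟨i, hi⟩ := exists_eq_ciSup_of_finite (f := fun i => completion q S i)
  obtain ⟨k, hk⟩ := exists_completion_eq hgrid S i
  have h : makespan q S = k / T₀ := hi.symm.trans hk
  rw [h]
  refine lowerBound_le (nonempty_partialLP_of_completion_le (nonneg_of_grid hgrid) hS fun i => ?_)
  exact h ▸ completion_le_makespan q S i

theorem exists_feasible (hm : 1 ≤ m) (hgrid : ∃ a : Fin n → ℕ, ∀ j, q j = a j / T₀)
    (v : Node n m) :
    ∃ k : ℕ, (partialLP (unfixed v) q (overhead q v) ((k : ℝ) / (T₀ : ℝ))).Nonempty := by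
  have : Nonempty (Fin m) := ⟨⟨0, hm⟩⟩
  obtain ⟨S, hS⟩ := exists_extends hm v
  obtain ⟨i, hi⟩ := exists_eq_ciSup_of_finite (f := fun i => completion q S i)
  obtain ⟨k, hk⟩ := exists_completion_eq hgrid S i
  refine ⟨k, nonempty_partialLP_of_completion_le (nonneg_of_grid hgrid) hS fun i' => ?_⟩
  rw [← hk, show completion q S i = makespan q S from hi]
  exact completion_le_makespan q S i'

theorem nonempty_partialLP_lowerBound (hm : 1 ≤ m)
    (hgrid : ∃ a : Fin n → ℕ, ∀ j, q j = a j / T₀) (v : Node n m) :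
    (partialLP (unfixed v) q (overhead q v) (lowerBound T₀ q v)).Nonempty :=
  Nat.sInf_mem (exists_feasible hm hgrid v)

theorem lowerBound_mono (hm : 1 ≤ m) (hgrid : ∃ a : Fin n → ℕ, ∀ j, q j = a j / T₀)
    {u v : Node n m} (huv : Refines u v) : lowerBound T₀ q v ≤ lowerBound T₀ q u :=
  lowerBound_le (nonempty_partialLP_of_refines (nonneg_of_grid hgrid) huv
    (nonempty_partialLP_lowerBound hm hgrid u))

theorem exists_isVertex (hm : 1 ≤ m) (hgrid : ∃ a : Fin n → ℕ, ∀ j, q j = a j / T₀)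
    (v : Node n m) : ∃ x, IsVertex T₀ q v x :=
  isCompact_partialLP.extremePoints_nonempty (nonempty_partialLP_lowerBound hm hgrid v)

/-- Identifies the lower bound of the root with `T₀ / T₀`; by monotonicity along the tree, all lower
bounds are then at least 1. -/
theorem root_feasible_iff {p : Fin n → ℕ} (σ : Equiv.Perm (Fin n)) (hg : globalOpt m p ≠ 0)
    (k : ℕ) :
    (partialLP (unfixed (fun _ => none : Node n m)) (normalized m p σ)
      (overhead (normalized m p σ) (fun _ => none : Node n m))
      ((k : ℝ) / (globalOpt m p : ℝ))).Nonempty ↔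
    (partialLP univ (fun j => (p j : ℝ)) (fun _ : Fin m => (0 : ℝ)) (k : ℝ)).Nonempty := by
  have hg' : (0 : ℝ) < globalOpt m p := by exact_mod_cast Nat.pos_of_ne_zero hg
  have hU : unfixed (fun _ => none : Node n m) = univ := by simp [unfixed]
  have hO : overhead (normalized m p σ) (fun _ => none : Node n m) = fun _ => 0 := by
    ext i
    simp [overhead]
  rw [hU, hO]
  constructor
  · rintro ⟨x, hx⟩
    refine ⟨fun j i => x (σ.symm j) i, fun j _ => hx.1 _ (mem_univ _), fun i => ?_,
      fun j i => hx.2.2.1 _ i, fun j i h => hx.2.2.2 _ i ?_⟩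
    · have h1 := hx.2.1 i
      rw [← Equiv.sum_comp σ]
      simp only [normalized, div_mul_eq_mul_div, ← sum_div, sub_zero] at h1
      simpa using (div_le_div_iff_of_pos_right hg').1 h1
    · refine h.imp (by simp) fun h => ?_
      simpa [normalized] using div_lt_div_of_pos_right h hg'
  · rintro ⟨x, hx⟩
    refine ⟨fun j i => x (σ j) i, fun j _ => hx.1 _ (mem_univ _), fun i => ?_,
      fun j i => hx.2.2.1 _ i, fun j i h => hx.2.2.2 _ i ?_⟩
    · have h1 := hx.2.1 i
      rw [← Equiv.sum_comp σ] at h1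
      simp only [normalized, div_mul_eq_mul_div, ← sum_div, sub_zero] at h1 ⊢
      exact div_le_div_of_nonneg_right h1 hg'.le
    · refine h.imp (by simp) fun h => ?_
      exact (div_lt_div_iff_of_pos_right hg').1 h

theorem globalOpt_feasible (hm : 1 ≤ m) (p : Fin n → ℕ) :
    (partialLP univ (fun j => (p j : ℝ)) (fun _ : Fin m => (0 : ℝ)) (globalOpt m p : ℝ)).Nonempty := by
  refine Nat.sInf_mem (s := {T : ℕ |
    (partialLP univ (fun j => (p j : ℝ)) (fun _ : Fin m => (0 : ℝ)) (T : ℝ)).Nonempty}) ?_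
  obtain ⟨k, hk⟩ := exists_feasible (T₀ := 1) (q := fun j => (p j : ℝ)) hm
    ⟨p, by simp⟩ (fun _ => none : Node n m)
  refine ⟨k, ?_⟩
  have hU : unfixed (fun _ => none : Node n m) = univ := by simp [unfixed]
  have hO : overhead (fun j => (p j : ℝ)) (fun _ => none : Node n m) = fun _ => 0 := by
    ext i
    simp [overhead]
  simpa [hU, hO] using hk

theorem le_globalOpt (hm : 1 ≤ m) (p : Fin n → ℕ) (j : Fin n) : p j ≤ globalOpt m p := by
  obtain ⟨x, hx⟩ := globalOpt_feasible hm p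
  exact_mod_cast le_limit_of_mem hx (mem_univ j)

theorem sum_le_mul_globalOpt (hm : 1 ≤ m) (p : Fin n → ℕ) :
    ∑ j, (p j : ℝ) ≤ m * globalOpt m p := by
  obtain ⟨x, hx⟩ := globalOpt_feasible hm p
  calc ∑ j, (p j : ℝ) = ∑ j, ∑ i, (p j : ℝ) * x j i :=
        sum_congr rfl fun j _ => by rw [← mul_sum, hx.1 j (mem_univ j), mul_one]
    _ = ∑ i, ∑ j, (p j : ℝ) * x j i := sum_comm
    _ ≤ ∑ _i : Fin m, (globalOpt m p : ℝ) := sum_le_sum fun i _ => by simpa using hx.2.1 i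
    _ = m * globalOpt m p := by simp

theorem scaled_normalized (hm : 1 ≤ m) {p : Fin n → ℕ} {σ : Equiv.Perm (Fin n)}
    (hσ : Antitone (p ∘ σ)) : Scaled m (globalOpt m p) (normalized m p σ) := by
  have hgrid : ∃ a : Fin n → ℕ, ∀ j, normalized m p σ j = a j / globalOpt m p :=
    ⟨fun j => p (σ j), fun j => rfl⟩
  refine ⟨fun i j hij => ?_, hgrid, fun j => ?_, ?_, ?_, fun hg v => ?_⟩
  · have : p (σ j) ≤ p (σ i) := hσ hij
    simp only [normalized]
    gcongr
  · exact div_le_one_of_le₀ (by exact_mod_cast le_globalOpt hm p _) (Nat.cast_nonneg _)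
  · simp only [normalized, ← sum_div]
    rw [Equiv.sum_comp σ fun j => (p j : ℝ)]
    exact div_le_of_le_mul₀ (Nat.cast_nonneg _) (Nat.cast_nonneg _) (sum_le_mul_globalOpt hm p)
  · by_cases hg : globalOpt m p = 0
    · rw [hg, lowerBound_zero]
      exact zero_le_one
    · refine (lowerBound_le ((root_feasible_iff σ hg _).2 (globalOpt_feasible hm p))).trans ?_
      exact div_self_le_one _
  · have hg' : (0 : ℝ) < globalOpt m p := by exact_mod_cast Nat.pos_of_ne_zero hg
    refine le_trans ?_ (lowerBound_mono hm hgrid (u := v) (v := fun _ => none) (by simp [Refines]))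
    rw [lowerBound, one_le_div hg', Nat.cast_le]
    refine Nat.sInf_le (s := {T : ℕ |
      (partialLP univ (fun j => (p j : ℝ)) (fun _ : Fin m => (0 : ℝ)) (T : ℝ)).Nonempty}) ?_
    exact (root_feasible_iff σ hg _).1 (Nat.sInf_mem (exists_feasible hm hgrid _))

theorem Scaled.nonneg (h : Scaled m T₀ q) (j : Fin n) : 0 ≤ q j := nonneg_of_grid h.grid j

/-- This turns the additive rounding loss of a short job into a factor `1 + ε`. -/
theorem Scaled.le_mul_lowerBound (h : Scaled m T₀ q) {ε : ℝ} (hε : 0 ≤ ε) {j : Fin n}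
    (hj : q j ≤ ε) (v : Node n m) : q j ≤ ε * lowerBound T₀ q v := by
  by_cases hT : T₀ = 0
  · rw [eq_zero_of_grid h.grid hT, hT, lowerBound_zero, mul_zero]
  · exact hj.trans (le_mul_of_one_le_right hε (h.one_le hT v))

end LowerBound

/-! ### Geometric rounding -/

section GeomRound

variable {ε : ℝ}

theorem geomRound_spec (hε : 0 < ε) {x : ℝ} (hx : ε ≤ x) :
    ∃ k : ℕ, geomRound ε x = ε * (1 + ε) ^ k ∧ ε * (1 + ε) ^ k ≤ x ∧
      x < (1 + ε) * (ε * (1 + ε) ^ k) := by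
  obtain ⟨k, h1, h2⟩ := exists_nat_pow_near ((one_le_div hε).2 hx) (by linarith : 1 < 1 + ε)
  rw [le_div_iff₀' hε] at h1
  rw [div_lt_iff₀' hε] at h2
  refine ⟨k, ?_, h1, by rw [pow_succ] at h2; linarith⟩
  refine IsGreatest.csSup_eq ⟨⟨k, rfl, h1⟩, ?_⟩
  rintro y ⟨l, rfl, hl⟩
  have h3 : (1 + ε) ^ l < (1 + ε) ^ (k + 1) := lt_of_mul_lt_mul_left (hl.trans_lt h2) hε.le
  have h4 : l < k + 1 := (pow_lt_pow_iff_right₀ (by linarith)).1 h3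
  gcongr
  · linarith
  · omega

/-- The processing times in which only the jobs longer than `ε` are rounded. -/
noncomputable def roundLarge {n : ℕ} (ε : ℝ) (q : Fin n → ℝ) (j : Fin n) : ℝ :=
  open Classical in if ε < q j then geomRound ε (q j) else q j

variable {n : ℕ} {q : Fin n → ℝ}

theorem roundLarge_of_lt {j : Fin n} (h : ε < q j) : roundLarge ε q j = geomRound ε (q j) :=
  if_pos h

theorem roundLarge_le (hε : 0 < ε) (j : Fin n) : roundLarge ε q j ≤ q j := by
  by_cases h : ε < q j
  · obtain ⟨k, h1, h2, -⟩ := geomRound_spec hε h.le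
    rw [roundLarge_of_lt h, h1]
    exact h2
  · exact (if_neg h).le

theorem le_mul_roundLarge (hε : 0 < ε) (hq : ∀ j, 0 ≤ q j) (j : Fin n) :
    q j ≤ (1 + ε) * roundLarge ε q j := by
  by_cases h : ε < q j
  · obtain ⟨k, h1, -, h3⟩ := geomRound_spec hε h.le
    rw [roundLarge_of_lt h, h1]
    exact h3.le
  · rw [roundLarge, if_neg h]
    exact le_mul_of_one_le_left (hq j) (by linarith)

/-- Finitely many numbers suffice as rounded completion times of the nodes in the tree. -/
theorem exists_finset_load (hε : 0 < ε) (c : ℝ) :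
    ∃ V : Finset ℝ, ∀ (n m : ℕ) (q : Fin n → ℝ) (w : Node n m), (∀ j, q j ≤ 1) →
      (∀ j, w j ≠ none → ε < q j) → (∀ i, overhead q w i ≤ c) →
      ∀ i, overhead (fun j => geomRound ε (q j)) w i ∈ V := by
  classical
  obtain ⟨K, hK⟩ := pow_unbounded_of_one_lt (1 / ε) (by linarith : 1 < 1 + ε)
  set N := ⌈c / ε⌉₊
  -- A rounded load is determined by how many jobs have each rounded length. Lengths at most 1 leave
  -- exponents below `K`; a load at most `c` of jobs longer than `ε` has at most `N` jobs. Neither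
  -- bound depends on the instance.
  refine ⟨univ.image fun a : Fin K → Fin (N + 1) => ∑ k, (a k : ℝ) * (ε * (1 + ε) ^ (k : ℕ)),
    fun n m q w hq1 hlarge hc i => ?_⟩
  set s : Finset (Fin n) := {j | w j = some i} with hs
  have hlarge' : ∀ j ∈ s, ε < q j := fun j hj => hlarge j (by simp [(mem_filter.1 hj).2])
  have hsN : #s ≤ N := by
    have h1 : #s • ε ≤ ∑ j ∈ s, q j := card_nsmul_le_sum _ _ _ fun j hj => (hlarge' j hj).le
    have h2 : (#s : ℝ) ≤ c / ε := by
      rw [le_div_iff₀ hε, ← nsmul_eq_mul]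
      exact h1.trans (hc i)
    exact_mod_cast h2.trans (Nat.le_ceil _)
  have hκ : ∀ j, ∃ k : ℕ, j ∈ s → k < K ∧ geomRound ε (q j) = ε * (1 + ε) ^ k := by
    intro j
    by_cases hj : j ∈ s
    · obtain ⟨k, h1, h2, -⟩ := geomRound_spec hε (hlarge' j hj).le
      refine ⟨k, fun _ => ⟨?_, h1⟩⟩
      have h3 : (1 + ε) ^ k ≤ 1 / ε := by
        rw [le_div_iff₀' hε]
        exact h2.trans (hq1 j)
      exact (pow_lt_pow_iff_right₀ (by linarith)).1 (h3.trans_lt hK)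
    · exact ⟨0, fun h => absurd h hj⟩
  choose κ hκ using hκ
  refine mem_image.2 ⟨fun k => ⟨#{j ∈ s | κ j = k}, Nat.lt_succ_of_le
    ((card_le_card (filter_subset _ _)).trans hsN)⟩, mem_univ _, ?_⟩
  change _ = ∑ j ∈ s, geomRound ε (q j)
  rw [← sum_fiberwise_of_maps_to (t := range K) (g := κ) fun j hj => mem_range.2 (hκ j hj).1,
    ← Fin.sum_univ_eq_sum_range
      (fun k => ∑ j ∈ s with κ j = k, geomRound ε (q j)) K]
  refine sum_congr rfl fun k _ => ?_
  rw [sum_congr rfl fun j hj => show geomRound ε (q j) = ε * (1 + ε) ^ (k : ℕ) by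
    rw [(hκ j (mem_filter.1 hj).1).2, (mem_filter.1 hj).2], sum_const, nsmul_eq_mul]

end GeomRound

/-! ### Profiles, equivalence and good nodes -/

section Equivalence

variable {n m : ℕ} {ε : ℝ} {q : Fin n → ℝ}

/-- The fixed jobs of `v` are the first ones in the order. -/
def IsPrefix (v : Node n m) : Prop := ∀ j, v j = none ↔ depth v ≤ j

/-- The subtree of `v` contains a schedule that has makespan at most `c` when the jobs longer than
`ε` are rounded. -/
def Good (ε : ℝ) (q : Fin n → ℝ) (c : ℝ) (v : Node n m) : Prop :=
  ∃ S, Extends S v ∧ makespan (roundLarge ε q) S ≤ c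

theorem exists_perm_of_equivalent {u w : Node n m} (h : Equivalent ε q w u) :
    ∃ π : Equiv.Perm (Fin m), ∀ i, overhead (fun j => geomRound ε (q j)) u (π i) =
      overhead (fun j => geomRound ε (q j)) w i := by
  classical
  have key : ∀ c, Nonempty ({i // overhead (fun j => geomRound ε (q j)) w i = c} ≃
      {i // overhead (fun j => geomRound ε (q j)) u i = c}) := fun c => by
    rw [← Fintype.card_eq, Fintype.card_subtype, Fintype.card_subtype]
    have := congrFun h c
    simp only [profile] at this
    convert this
  exact ⟨Equiv.ofFiberEquiv fun c => (key c).some, fun i => Equiv.ofFiberEquiv_map _ i⟩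

theorem overhead_roundLarge {v : Node n m} (hv : ∀ j, v j ≠ none → ε < q j) (i : Fin m) :
    overhead (roundLarge ε q) v i = overhead (fun j => geomRound ε (q j)) v i :=
  sum_congr rfl fun j hj => roundLarge_of_lt (hv j (by simp [(mem_filter.1 hj).2]))

theorem completion_eq_overhead_add {S : Fin n → Fin m} {v : Node n m} (hS : Extends S v)
    (i : Fin m) : completion q S i = overhead q v i + ∑ j with v j = none ∧ S j = i, q j := by
  simp only [completion, overhead, sum_filter, ← sum_add_distrib]
  refine sum_congr rfl fun j _ => ?_
  rcases hv : v j with _ | i'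
  · simp
  · simp [hS j i' hv]

/-- Equivalent nodes are equally good. -/
theorem Good.of_equivalent (hm : 1 ≤ m) {c : ℝ} {u w : Node n m} (hu : IsPrefix u)
    (hw : IsPrefix w) (hdepth : depth w = depth u) (h : Equivalent ε q w u)
    (hlarge : ∀ j, u j ≠ none → ε < q j) (hgood : Good ε q c u) : Good ε q c w := by
  obtain ⟨S, hS, hc⟩ := hgood
  obtain ⟨π, hπ⟩ := exists_perm_of_equivalent h
  have hnone : ∀ j, w j = none ↔ u j = none := fun j => by rw [hw j, hu j, hdepth]
  -- Both nodes fix the same initial segment of jobs. Keep what `w` fixes and let the remaining jobs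
  -- follow `S`, with machines relabelled so that the rounded overheads match.
  have hE : Extends (fun j => (w j).getD (π.symm (S j))) w := fun j i hj => by simp [hj]
  refine ⟨_, hE, makespan_le hm fun i => ?_⟩
  refine le_trans (le_of_eq ?_) ((completion_le_makespan _ S (π i)).trans hc)
  rw [completion_eq_overhead_add hE, completion_eq_overhead_add hS, overhead_roundLarge hlarge,
    overhead_roundLarge fun j hj => hlarge j fun h => hj ((hnone j).2 h), hπ i]
  congr 1
  refine sum_congr (filter_congr fun j _ => ?_) fun _ _ => rfl
  rw [hnone j]
  refine and_congr_right fun hj => ?_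
  rw [(hnone j).2 hj, Option.getD_none, Equiv.symm_apply_eq]

theorem Good.lowerBound_le (hm : 1 ≤ m) {T₀ : ℕ} (hgrid : ∃ a : Fin n → ℕ, ∀ j, q j = a j / T₀)
    (hε : 0 < ε) {c : ℝ} {v : Node n m} (h : Good ε q c v) :
    lowerBound T₀ q v ≤ (1 + ε) * c := by
  obtain ⟨S, hS, hc⟩ := h
  calc lowerBound T₀ q v ≤ makespan q S := lowerBound_le_makespan hm hgrid hS
    _ ≤ makespan (fun j => (1 + ε) * roundLarge ε q j) S :=
      makespan_mono hm (le_mul_roundLarge hε (nonneg_of_grid hgrid)) S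
    _ = (1 + ε) * makespan (roundLarge ε q) S := makespan_const_mul (by linarith) S
    _ ≤ (1 + ε) * c := by gcongr

/-- Few nodes of bounded depth are pairwise inequivalent. -/
theorem card_le_of_inequivalent {listed : Finset (Node n m)} {V : Finset ℝ} {L : ℕ}
    (hL : ∀ w ∈ listed, depth w ≤ L)
    (hV : ∀ w ∈ listed, ∀ i, overhead (fun j => geomRound ε (q j)) w i ∈ V)
    (hinj : ∀ w ∈ listed, ∀ w' ∈ listed, depth w = depth w' → Equivalent ε q w w' → w = w') :
    #listed ≤ (L + 1) * (m + 1) ^ #V := by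
  classical
  have : #(range (L + 1) ×ˢ Fintype.piFinset fun _ : V => range (m + 1)) =
      (L + 1) * (m + 1) ^ #V := by simp
  rw [← this]
  refine card_le_card_of_injOn (fun w => (depth w, fun c => profile ε q w c)) (fun w hw => ?_) ?_
  · simp only [coe_product, Set.mem_prod, mem_coe, mem_range, Fintype.mem_piFinset]
    refine ⟨Nat.lt_succ_of_le (hL w hw), fun c => Nat.lt_succ_of_le ?_⟩
    exact (card_filter_le _ _).trans (by simp)
  · intro w hw w' hw' h
    refine hinj w hw w' hw' (congrArg Prod.fst h) (funext fun c => ?_)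
    by_cases hc : c ∈ V
    · exact congrFun (congrArg Prod.snd h) ⟨c, hc⟩
    · have h0 : ∀ w ∈ listed, profile ε q w c = 0 := fun w hw =>
        card_eq_zero.2 (filter_eq_empty_iff.2 fun i _ h => hc (h ▸ hV w hw i))
      rw [h0 w hw, h0 w' hw']

end Equivalence

/-! ### The effect of branching on the tree -/

section Branching

variable {n m : ℕ} {ε : ℝ} {T₀ : ℕ} {q : Fin n → ℝ}

theorem Discarded.mono {B : Fin n → Fin m} {L L' : Finset (Node n m)} {u : Node n m}
    (h : Discarded ε T₀ q B L u) (hL : L ⊆ L') : Discarded ε T₀ q B L' u :=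
  h.imp_right fun h => h.imp_right fun ⟨w, hw, h⟩ => ⟨w, hL hw, h⟩

/-- The effect of examining a list of new nodes. -/
structure Examined (ε : ℝ) (T₀ : ℕ) (q : Fin n → ℝ) (B : Fin n → Fin m) (new : Node n m → Prop)
    (a r : Finset (Node n m) × Finset (Node n m)) : Prop where
  active_subset : a.1 ⊆ r.1
  listed_subset : a.2 ⊆ r.2
  active_sub_listed : r.1 ⊆ r.2
  mem_active : ∀ w ∈ r.1, w ∈ a.1 ∨ new w
  mem_listed : ∀ w ∈ r.2, w ∈ a.2 ∨
    (w ∈ r.1 ∧ new w ∧ ∀ i, overhead q w i ≤ 2 * (1 + ε) ^ 2)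
  -- This covers added nodes too: in the final list, such a node is equivalent to itself.
  discarded : ∀ w, new w → Discarded ε T₀ q B r.2 w
  inequivalent : (∀ w ∈ a.2, ∀ w' ∈ a.2, depth w = depth w' → Equivalent ε q w w' → w = w') →
    ∀ w ∈ r.2, ∀ w' ∈ r.2, depth w = depth w' → Equivalent ε q w w' → w = w'
  card : #r.1 + #a.2 ≤ #r.2 + #a.1

theorem examined_addNode (B : Fin n → Fin m) {a : Finset (Node n m) × Finset (Node n m)}
    (ha : a.1 ⊆ a.2) (u : Node n m) :
    Examined ε T₀ q B (fun w => w = u) a (addNode ε T₀ q B a u) := by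
  classical
  by_cases h : Discarded ε T₀ q B a.2 u
  · rw [addNode, if_pos h]
    exact ⟨Subset.rfl, Subset.rfl, ha, fun w => Or.inl, fun w => Or.inl, fun w hw => hw ▸ h,
      fun h => h, (add_comm _ _).le⟩
  · rw [addNode, if_neg h]
    simp only [Discarded, not_or, not_exists, not_and, not_lt] at h
    obtain ⟨-, hle, hne⟩ := h
    have hua : u ∉ a.2 := fun hu => hne u hu rfl rfl
    refine ⟨subset_insert _ _, subset_insert _ _, insert_subset_insert _ ha, fun w hw => ?_,
      fun w hw => ?_, fun w hw => ?_, fun hin w hw w' hw' hd he => ?_, ?_⟩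
    · exact (mem_insert.1 hw).symm
    · refine (mem_insert.1 hw).symm.imp_right fun h => ?_
      subst h
      exact ⟨mem_insert_self _ _, rfl, hle⟩
    · subst hw
      exact Or.inr (Or.inr ⟨w, mem_insert_self _ _, rfl, rfl⟩)
    · rcases mem_insert.1 hw with h1 | h1 <;> rcases mem_insert.1 hw' with h2 | h2
      · exact h1.trans h2.symm
      · subst h1
        exact absurd he.symm (hne w' h2 hd.symm)
      · subst h2
        exact absurd he (hne w h1 hd)
      · exact hin w h1 w' h2 hd he
    · rw [card_insert_of_notMem fun h => hua (ha h), card_insert_of_notMem hua]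
      omega

theorem Examined.trans {B : Fin n → Fin m} {N N' : Node n m → Prop}
    {a b r : Finset (Node n m) × Finset (Node n m)} (h : Examined ε T₀ q B N a b)
    (h' : Examined ε T₀ q B N' b r) : Examined ε T₀ q B (fun w => N w ∨ N' w) a r where
  active_subset := h.active_subset.trans h'.active_subset
  listed_subset := h.listed_subset.trans h'.listed_subset
  active_sub_listed := h'.active_sub_listed
  mem_active w hw := by
    rcases h'.mem_active w hw with hw | hw
    · exact (h.mem_active w hw).imp_right Or.inl
    · exact Or.inr (Or.inr hw)
  mem_listed w hw := by
    rcases h'.mem_listed w hw with hw | ⟨h1, h2, h3⟩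
    · exact (h.mem_listed w hw).imp_right fun ⟨h1, h2, h3⟩ =>
        ⟨h'.active_subset h1, Or.inl h2, h3⟩
    · exact Or.inr ⟨h1, Or.inr h2, h3⟩
  discarded w hw := hw.elim (fun hw => (h.discarded w hw).mono h'.listed_subset)
    (h'.discarded w)
  inequivalent hin := h'.inequivalent (h.inequivalent hin)
  card := by
    have := h.card
    have := h'.card
    omega

theorem examined_foldl (B : Fin n → Fin m) (f : Fin m → Node n m) (l : List (Fin m))
    {a : Finset (Node n m) × Finset (Node n m)} (ha : a.1 ⊆ a.2) :
    Examined ε T₀ q B (fun w => ∃ i ∈ l, w = f i) a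
      (l.foldl (fun a i => addNode ε T₀ q B a (f i)) a) := by
  induction l generalizing a with
  | nil =>
    exact ⟨Subset.rfl, Subset.rfl, ha, fun w => Or.inl, fun w => Or.inl, by simp, fun h => h,
      (add_comm _ _).le⟩
  | cons i l ih =>
    have h1 := examined_addNode (ε := ε) (T₀ := T₀) (q := q) B ha (f i)
    have h2 := h1.trans (ih h1.active_sub_listed)
    simpa using h2

theorem examined_branch (B : Fin n → Fin m) {s : State n m} (hs : s.active ⊆ s.listed)
    (v : Node n m) (j : Fin n) :
    Examined ε T₀ q B (fun w => ∃ i, w = Function.update v j (some i))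
      (@Finset.erase _ (Classical.decEq _) s.active v, s.listed) (branch ε T₀ q B s v j) := by
  have := examined_foldl (ε := ε) (T₀ := T₀) (q := q) B
    (fun i => Function.update v j (some i)) (List.finRange m)
    (a := (@Finset.erase _ (Classical.decEq _) s.active v, s.listed))
    ((@Finset.erase_subset _ (Classical.decEq _) _ _).trans hs)
  simp only [List.mem_finRange, true_and] at this
  unfold branch
  convert this

theorem depth_eq_of_isLeast {v : Node n m} (hv : IsPrefix v) {j : Fin n}
    (hj : IsLeast (unfixed v : Set (Fin n)) j) : depth v = j := by
  have hmem : ∀ l, l ∈ (unfixed v : Set (Fin n)) ↔ v l = none := by simp [unfixed]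
  refine le_antisymm ((hv j).1 ((hmem j).1 hj.1)) ?_
  by_contra! h
  have hlt : depth v < n := h.trans j.2
  have := hj.2 ((hmem ⟨depth v, hlt⟩).2 ((hv _).2 le_rfl))
  exact absurd (Fin.le_def.1 this) (not_le.2 h)

theorem depth_update {v : Node n m} {j : Fin n} (hj : v j = none) (i : Fin m) :
    depth (Function.update v j (some i)) = depth v + 1 := by
  classical
  have : ({l | Function.update v j (some i) l ≠ none} : Finset (Fin n)) =
      insert j ({l | v l ≠ none} : Finset (Fin n)) := by
    ext l
    by_cases h : l = j
    · subst h
      simp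
    · simp [h]
  simp only [depth]
  rw [this, card_insert_of_notMem (by simp [hj])]

theorem isPrefix_update {v : Node n m} (hv : IsPrefix v) {j : Fin n}
    (hj : IsLeast (unfixed v : Set (Fin n)) j) (i : Fin m) :
    IsPrefix (Function.update v j (some i)) := by
  have hd := depth_eq_of_isLeast hv hj
  have hj0 : v j = none := by simpa [unfixed] using hj.1
  intro l
  rw [depth_update hj0]
  by_cases h : l = j
  · subst h
    simp [hd]
  · rw [Function.update_of_ne h, hv l]
    have : (l : ℕ) ≠ j := fun h' => h (Fin.ext h')
    omega

theorem refines_update {v : Node n m} {j : Fin n} (hj : v j = none) (i : Fin m) :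
    Refines (Function.update v j (some i)) v := fun l hl =>
  Function.update_of_ne (fun h => hl (by rw [h, hj])) _ _

theorem Extends.update {S : Fin n → Fin m} {v : Node n m} (hS : Extends S v) (j : Fin n) :
    Extends S (Function.update v j (some (S j))) := fun l i h => by
  by_cases hl : l = j
  · subst hl
    simpa using h
  · rw [Function.update_of_ne hl] at h
    exact hS l i h

end Branching

/-! ### The invariant and its preservation -/

section Invariant

variable {n m : ℕ} {ε c : ℝ} {T₀ : ℕ} {q : Fin n → ℝ} {s s' : State n m}

/-- A schedule with makespan at most `c` has been found. -/
def Found (q : Fin n → ℝ) (best : Option (Fin n → Fin m)) (c : ℝ) : Prop :=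
  ∃ B, best = some B ∧ makespan q B ≤ c

theorem makespan_champion_le (q : Fin n → ℝ) (best : Option (Fin n → Fin m))
    (S : Fin n → Fin m) : makespan q (champion q best S) ≤ makespan q S := by
  unfold champion
  split
  · exact le_rfl
  · split_ifs with h
    · exact le_rfl
    · exact not_lt.1 h

theorem Found.champion {best : Option (Fin n → Fin m)} (h : Found q best c)
    (S : Fin n → Fin m) : makespan q (champion q best S) ≤ c := by
  obtain ⟨B, rfl, hB⟩ := h
  refine le_trans ?_ hB
  unfold EqProf.champion
  dsimp only
  split_ifs with h
  · exact h.le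
  · exact le_rfl

/-- The invariant of the algorithm, where `c` is the optimal makespan: all nodes in the tree fix
only jobs longer than `ε`, they are pairwise inequivalent, and the tree has not been pruned below a
good node without a good node of the next level, or a good schedule, having been found. -/
structure Invariant (ε : ℝ) (T₀ : ℕ) (q : Fin n → ℝ) (c : ℝ) (s : State n m) : Prop where
  active_subset : s.active ⊆ s.listed
  root_mem : (fun _ => none) ∈ s.listed
  isPrefix : ∀ w ∈ s.listed, IsPrefix w
  large : ∀ w ∈ s.listed, ∀ j, w j ≠ none → ε < q j
  overhead_le : ∀ w ∈ s.listed, ∀ i, overhead q w i ≤ 2 * (1 + ε) ^ 2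
  inequivalent : ∀ w ∈ s.listed, ∀ w' ∈ s.listed, depth w = depth w' → Equivalent ε q w w' → w = w'
  -- Every processed node stays in the tree but is no longer active.
  card_le : s.processed + #s.active ≤ #s.listed
  progress : ∀ w ∈ s.listed, Good ε q c w → w ∈ s.active ∨ Found q s.best ((1 + ε) * c) ∨
    ∃ w' ∈ s.listed, Good ε q c w' ∧ depth w' = depth w + 1

theorem invariant_initial : Invariant ε T₀ q c (initial n m) where
  active_subset := Subset.rfl
  root_mem := mem_singleton_self _
  isPrefix w hw := by
    rw [mem_singleton.1 hw]
    intro j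
    simp [depth]
  large w hw := by
    rw [mem_singleton.1 hw]
    simp
  overhead_le w hw i := by
    rw [mem_singleton.1 hw]
    simp only [overhead, reduceCtorEq, filter_false, sum_empty]
    positivity
  inequivalent w hw w' hw' _ _ := (mem_singleton.1 hw).trans (mem_singleton.1 hw').symm
  card_le := by simp [initial]
  progress w hw _ := Or.inl hw

/-- A good node of maximal depth has no good node on the next level, so only the first two
alternatives of `progress` remain. -/
theorem Invariant.exists_good (h : Invariant ε T₀ q c s)
    (hroot : Good ε q c (fun _ => none : Node n m)) :
    (∃ w ∈ s.active, Good ε q c w) ∨ Found q s.best ((1 + ε) * c) := by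
  classical
  obtain ⟨w, hw, hmax⟩ := exists_max_image {w ∈ s.listed | Good ε q c w} depth
    ⟨_, mem_filter.2 ⟨h.root_mem, hroot⟩⟩
  obtain ⟨hw, hg⟩ := mem_filter.1 hw
  rcases h.progress w hw hg with h1 | h1 | ⟨w', hw', hg', hd⟩
  · exact Or.inl ⟨w, h1, hg⟩
  · exact Or.inr h1
  · have := hmax w' (mem_filter.2 ⟨hw', hg'⟩)
    omega

/-- Branching on a job longer than `ε` keeps the invariant. -/
theorem Invariant.branch (hm : 1 ≤ m) (hε : 0 < ε)
    (hgrid : ∃ a : Fin n → ℕ, ∀ j, q j = a j / T₀) (hc : c ≤ 2)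
    (h : Invariant ε T₀ q c s) {v : Node n m} (hv : v ∈ s.active) {j : Fin n}
    (hj : IsLeast (unfixed v : Set (Fin n)) j) (hqj : ε < q j) (S : Fin n → Fin m) (b : Bool) :
    Invariant ε T₀ q c
      { active := (EqProf.branch ε T₀ q (champion q s.best S) s v j).1
        listed := (EqProf.branch ε T₀ q (champion q s.best S) s v j).2
        best := some (champion q s.best S)
        processed := s.processed + 1
        halted := b } := by
  classical
  have E := examined_branch (ε := ε) (T₀ := T₀) (q := q) (champion q s.best S) h.active_subset v j
  set B := champion q s.best S
  set r := EqProf.branch ε T₀ q B s v j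
  have hvl := h.active_subset hv
  have hj0 : v j = none := by simpa [unfixed] using hj.1
  have hpre : ∀ w ∈ r.2, IsPrefix w := fun w hw => by
    rcases E.mem_listed w hw with hw | ⟨-, ⟨i, rfl⟩, -⟩
    · exact h.isPrefix w hw
    · exact isPrefix_update (h.isPrefix v hvl) hj i
  have hlu : ∀ i l, Function.update v j (some i) l ≠ none → ε < q l := fun i l hl => by
    by_cases hlj : l = j
    · exact hlj ▸ hqj
    · rw [Function.update_of_ne hlj] at hl
      exact h.large v hvl l hl
  refine ⟨E.active_sub_listed, E.listed_subset h.root_mem, hpre, fun w hw => ?_, fun w hw => ?_,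
    E.inequivalent h.inequivalent, ?_, fun w hw hgood => ?_⟩
  · rcases E.mem_listed w hw with hw | ⟨-, ⟨i, rfl⟩, -⟩
    · exact h.large w hw
    · exact hlu i
  · rcases E.mem_listed w hw with hw | ⟨-, -, hle⟩
    · exact h.overhead_le w hw
    · exact hle
  · have h1 := E.card
    have h2 := h.card_le
    have h3 := @Finset.card_erase_of_mem _ _ _ (Classical.decEq _) hv
    have h4 := card_pos.2 ⟨v, hv⟩
    simp only [h3] at h1
    dsimp only
    omega
  · rcases E.mem_listed w hw with hw | ⟨hw, -⟩
    · rcases h.progress w hw hgood with h1 | h1 | ⟨w', hw', h1⟩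
      · by_cases hwv : w = v
        · subst hwv
          obtain ⟨S', hS', hSc⟩ := id hgood
          have hgu : Good ε q c (Function.update w j (some (S' j))) := ⟨S', hS'.update j, hSc⟩
          have hSq : makespan q S' ≤ (1 + ε) * c := by
            refine (makespan_mono hm (le_mul_roundLarge hε (nonneg_of_grid hgrid)) S').trans ?_
            rw [makespan_const_mul (by linarith)]
            gcongr
          -- The child that follows the good schedule `S'` is good. Pruning by lower bound means
          -- that `B` beats `S'`. The overhead cut-off cannot apply, as `(1 + ε) * c ≤ 2 * (1 + ε) ^
          -- 2`. An equivalent node of the tree inherits the goodness.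
          rcases E.discarded _ ⟨S' j, rfl⟩ with hd | ⟨i, hi⟩ | ⟨w', hw', hdep, heq⟩
          · exact Or.inr (Or.inl ⟨B, rfl,
              hd.le.trans ((lowerBound_le_makespan hm hgrid (hS'.update j)).trans hSq)⟩)
          · have h2 := overhead_le_completion (nonneg_of_grid hgrid) (hS'.update j) i
            have h3 := completion_le_makespan q S' i
            have h4 : (1 + ε) * c ≤ 2 * (1 + ε) ^ 2 := by nlinarith
            exact absurd hi (not_lt.2 (by linarith))
          · refine Or.inr (Or.inr ⟨w', hw', ?_, ?_⟩)
            · exact hgu.of_equivalent hm (isPrefix_update (h.isPrefix w hvl) hj _) (hpre w' hw')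
                hdep heq (hlu _)
            · rw [hdep, depth_update hj0]
        · exact Or.inl (E.active_subset
            ((@Finset.mem_erase _ (Classical.decEq _) _ _ _).2 ⟨hwv, h1⟩))
      · exact Or.inr (Or.inl ⟨B, rfl, h1.champion S⟩)
      · exact Or.inr (Or.inr ⟨w', E.listed_subset hw', h1⟩)
    · exact Or.inl hw

/-- An iteration keeps the invariant, unless the algorithm stops with a good schedule. -/
theorem Invariant.step (hm : 1 ≤ m) (hε : 0 < ε) (hq : Scaled m T₀ q) (hc : c ≤ 2)
    (hroot : Good ε q c (fun _ => none : Node n m)) (h : Invariant ε T₀ q c s)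
    (hstep : Step ε T₀ q s s') :
    s'.processed = s.processed + 1 ∧ s.active.Nonempty ∧
      (s'.halted = false → Invariant ε T₀ q c s' ∧ s'.active.Nonempty) ∧
      (s'.halted = true → Found q s'.best ((1 + ε) ^ 2 * c)) := by
  obtain ⟨-, v, x, ⟨hv, hmin, hx⟩, hproc⟩ := hstep
  have hgoodLB : Found q s.best ((1 + ε) * c) ∨ lowerBound T₀ q v ≤ (1 + ε) * c :=
    (h.exists_good hroot).symm.imp_right fun ⟨w, hw, hg⟩ =>
      (hmin w hw).trans (hg.lowerBound_le hm hq.grid hε)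
  have hc0 : 0 ≤ c := by
    obtain ⟨S, -, hS⟩ := hroot
    refine le_trans (makespan_nonneg hm (fun j => ?_) S) hS
    have := le_mul_roundLarge hε hq.nonneg j
    exact nonneg_of_mul_nonneg_right ((hq.nonneg j).trans this) (by linarith)
  have hcc : (1 + ε) * c ≤ (1 + ε) ^ 2 * c := by
    have : 1 + ε ≤ (1 + ε) ^ 2 := by nlinarith
    gcongr
  cases hproc with
  | integral S hx' hS =>
    refine ⟨rfl, ⟨v, hv⟩, fun h => absurd h (by simp), fun _ => ⟨_, rfl, ?_⟩⟩
    refine le_trans ?_ hcc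
    rcases hgoodLB with hF | hLB
    · exact hF.champion S
    · refine (makespan_champion_le q s.best S).trans ((makespan_le hm fun i => ?_).trans hLB)
      have := hS.completion_le hx.1 hq.nonneg le_rfl (fun j hj => absurd hj (hx' j)) i
      simpa using this
  | fractional y j S hx' hj hy hyj hxy hS =>
    refine ⟨rfl, ⟨v, hv⟩, fun hhalt => ?_, fun hhalt => ⟨_, rfl, ?_⟩⟩
    all_goals
      set B := champion q s.best S with hB
      have hj0 : v j = none := by simpa [unfixed] using hj.1
      have E := examined_branch (ε := ε) (T₀ := T₀) (q := q) B h.active_subset v j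
      have hLB : ∀ w ∈ (EqProf.branch ε T₀ q B s v j).1, lowerBound T₀ q v ≤ lowerBound T₀ q w := by
        intro w hw
        rcases E.mem_active w hw with hw | ⟨i, rfl⟩
        · exact hmin w ((@Finset.erase_subset _ (Classical.decEq _) _ _) hw)
        · exact lowerBound_mono hm hq.grid (refines_update hj0 i)
      have hBle : q j ≤ ε → makespan q B ≤ (1 + ε) * lowerBound T₀ q v := fun hqj => by
        refine (makespan_champion_le q s.best S).trans
          ((makespan_le hm fun i => ?_ : _ ≤ lowerBound T₀ q v + q j).trans ?_)
        · exact hS.completion_le hy.1 hq.nonneg (hq.nonneg j)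
            (fun k hk => hq.anti (hj.2 (hk.mem hy.1))) i
        · have := hq.le_mul_lowerBound hε.le hqj v
          linarith
    · have hns : ¬ Stops ε T₀ q B (EqProf.branch ε T₀ q B s v j).1 :=
        @of_decide_eq_false _ (Classical.propDecidable _) hhalt
      -- A short `j` would have triggered the stopping criterion: the rounding is within `1 + ε` of
      -- `LB(v)`, which bounds all active lower bounds from below, those of the children included.
      have hqj : ε < q j := by
        by_contra! hqj
        refine hns fun w hw => (hBle hqj).trans ?_
        have := hLB w hw
        gcongr
      refine ⟨h.branch hm hε hq.grid hc hv hj hqj S _, ?_⟩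
      by_contra hne
      rw [not_nonempty_iff_eq_empty] at hne
      exact hns fun w hw => absurd hw (by
        rw [show (EqProf.branch ε T₀ q B s v j).1 = ∅ from hne]
        simp)
    · have hst : Stops ε T₀ q B (EqProf.branch ε T₀ q B s v j).1 :=
        @of_decide_eq_true _ (Classical.propDecidable _) hhalt
      have hsq : ∀ {r : ℝ}, r ≤ (1 + ε) * c → (1 + ε) * r ≤ (1 + ε) ^ 2 * c := fun hr => by
        rw [pow_two, mul_assoc]
        gcongr
      -- For long `j` the new state has a good active node or a good enough schedule. For short `j`
      -- the invariant may fail after branching, so the bound comes from `LB(v)` before it.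
      by_cases hqj : ε < q j
      · rcases (h.branch hm hε hq.grid hc hv hj hqj S true).exists_good hroot with
          ⟨w, hw, hg⟩ | ⟨B', hB', hle⟩
        · exact (hst w hw).trans (hsq (hg.lowerBound_le hm hq.grid hε))
        · rw [← Option.some.inj hB'] at hle
          exact hle.trans hcc
      · rcases hgoodLB with hF | hle
        · exact (hF.champion S).trans hcc
        · exact (hBle (not_lt.1 hqj)).trans (hsq hle)

/-- Every selected node can be processed. -/
theorem exists_processes (hq : Scaled m T₀ q) {v : Node n m} {x : Fin n → Fin m → ℝ}
    (hx : IsVertex T₀ q v x) : ∃ s', Processes ε T₀ q s v x s' := by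
  by_cases hfr : ∃ k, Fractional x k
  · obtain ⟨k, hk⟩ := hfr
    have hne : (unfixed v).Nonempty := ⟨k, hk.mem hx.1⟩
    have hj := (unfixed v).isLeast_min' hne
    obtain ⟨y, hy, hyj, hyx⟩ := exists_vertex_fractional hx hq.nonneg hk hj.1
      fun k hk => hq.anti (hj.2 hk)
    obtain ⟨S, hS⟩ := exists_isRounding hy
    exact ⟨_, .fractional y _ S ⟨k, hk⟩ hj hy hyj hyx hS⟩
  · obtain ⟨S, hS⟩ := exists_isRounding hx
    exact ⟨_, .integral S (not_exists.1 hfr) hS⟩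

/-- Some schedule has makespan at most twice the global fractional optimum. -/
theorem exists_makespan_le_two (hm : 1 ≤ m) (hq : Scaled m T₀ q) :
    ∃ S : Fin n → Fin m, makespan q S ≤ 2 := by
  obtain ⟨x, hx⟩ := exists_isVertex hm hq.grid (fun _ => none : Node n m)
  obtain ⟨S, hS⟩ := exists_isRounding hx
  refine ⟨S, makespan_le hm fun i => ?_⟩
  have h1 := hS.completion_le hx.1 hq.nonneg zero_le_one (fun j _ => hq.le_one j) i
  have h2 := hq.root_le
  linarith

/-- The number of nodes in the tree. -/
theorem Invariant.card_listed_le (hε : 0 < ε) (hq : Scaled m T₀ q)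
    (h : Invariant ε T₀ q c s) {V : Finset ℝ}
    (hV : ∀ w : Node n m, (∀ j, w j ≠ none → ε < q j) →
      (∀ i, overhead q w i ≤ 2 * (1 + ε) ^ 2) →
      ∀ i, overhead (fun j => geomRound ε (q j)) w i ∈ V) :
    (#s.listed : ℝ) ≤ (m / ε + 1) * (m + 1) ^ #V := by
  classical
  have h1 : #s.listed ≤ (#{j | ε < q j} + 1) * (m + 1) ^ #V :=
    card_le_of_inequivalent
      (fun w hw => card_le_card fun j hj => by
        rw [mem_filter] at hj ⊢
        exact ⟨hj.1, h.large w hw j hj.2⟩)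
      (fun w hw => hV w (h.large w hw) (h.overhead_le w hw)) h.inequivalent
  have h2 : (#{j | ε < q j} : ℝ) ≤ m / ε := by
    rw [le_div_iff₀ hε, ← nsmul_eq_mul]
    refine (card_nsmul_le_sum _ q ε fun j hj => (mem_filter.1 hj).2.le).trans ?_
    exact (sum_le_sum_of_subset_of_nonneg (subset_univ _) fun j _ _ => hq.nonneg j).trans hq.sum_le
  calc (#s.listed : ℝ) ≤ (#{j | ε < q j} + 1) * (m + 1) ^ #V := by exact_mod_cast h1
    _ ≤ _ := by gcongr

end Invariant

/-! ### Executions: termination, guarantee and node count -/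

section Executions

variable {n m : ℕ} {ε c : ℝ} {T₀ : ℕ} {q : Fin n → ℝ} {s : State n m}

theorem reachable_spec (hm : 1 ≤ m) (hε : 0 < ε) (hq : Scaled m T₀ q) (hc : c ≤ 2)
    (hroot : Good ε q c (fun _ => none : Node n m)) {N : ℝ}
    (hN : ∀ s : State n m, Invariant ε T₀ q c s → (#s.listed : ℝ) ≤ N)
    (hs : Relation.ReflTransGen (Step ε T₀ q) (initial n m) s) :
    (s.halted = false → Invariant ε T₀ q c s ∧ s.active.Nonempty) ∧
      (s.halted = true → Found q s.best ((1 + ε) ^ 2 * c)) ∧ (s.processed : ℝ) ≤ N := by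
  induction hs with
  | refl =>
    refine ⟨fun _ => ⟨invariant_initial, singleton_nonempty _⟩, fun h => absurd h (by simp [initial]),
      le_trans ?_ (hN _ invariant_initial)⟩
    simp [initial]
  | tail _ hstep ih =>
    have hinv := (ih.1 hstep.1).1
    obtain ⟨h1, h2, h3, h4⟩ := hinv.step hm hε hq hc hroot hstep
    refine ⟨h3, h4, le_trans ?_ (hN _ hinv)⟩
    -- The count is read off the state before the iteration, where the invariant holds even if the
    -- algorithm stops now: the selected node is still active, so `processed + 1 ≤ #listed`.
    rw [h1]
    have h5 := hinv.card_le
    have h6 := h2.card_pos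
    exact_mod_cast (by omega)

/-- With one machine, the relaxation is integral. -/
theorem processed_le_one {s : State n 1}
    (hs : Relation.ReflTransGen (Step ε T₀ q) (initial n 1) s) :
    (s.halted = false → s.processed = 0) ∧ s.processed ≤ 1 := by
  induction hs with
  | refl => simp [initial]
  | tail _ hstep ih =>
    obtain ⟨hh, v, x, ⟨-, -, hx⟩, hproc⟩ := hstep
    cases hproc with
    | integral S _ _ => exact ⟨fun h => absurd h (by simp), by simp [ih.1 hh]⟩
    | fractional y j S hx' _ _ _ _ _ =>
      obtain ⟨k, hk⟩ := hx'
      have h1 := hk.two_le_card hx.1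
      have h2 := card_filter_le (univ : Finset (Fin 1)) fun i => x k i ≠ 0
      rw [card_univ, Fintype.card_fin] at h2
      omega

theorem normalized_mul (hm : 1 ≤ m) (p : Fin n → ℕ) (σ : Equiv.Perm (Fin n)) (j : Fin n) :
    (globalOpt m p : ℝ) * normalized m p σ j = p (σ j) := by
  by_cases hg : globalOpt m p = 0
  · have := le_globalOpt hm p (σ j)
    have h0 : p (σ j) = 0 := by omega
    simp [hg, h0]
  · have : (globalOpt m p : ℝ) ≠ 0 := by exact_mod_cast hg
    rw [normalized]
    field_simp

theorem makespan_eq_mul (hm : 1 ≤ m) (p : Fin n → ℕ) (σ : Equiv.Perm (Fin n))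
    (S : Fin n → Fin m) : makespan (fun j => (p j : ℝ)) S =
      globalOpt m p * makespan (normalized m p σ) fun j => S (σ j) := by
  rw [← makespan_const_mul (Nat.cast_nonneg _), ← makespan_comp_perm S σ]
  simp only [normalized_mul hm]

theorem exists_exponent (hε : 0 < ε) (K : ℕ) :
    ∃ F : ℕ, ∀ m : ℕ, 2 ≤ m →
      ((m : ℝ) / ε + 1) * (m + 1) ^ K ≤ 2 * (m : ℝ) ^ (F + 1) / ε := by
  obtain ⟨C, hC⟩ := pow_unbounded_of_one_lt (1 + ε) (one_lt_two (α := ℝ))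
  -- From `m + ε ≤ m * (1 + ε) ≤ m * 2 ^ C ≤ m * m ^ C` and `m + 1 ≤ m ^ 2`; both need `m ≥ 2`.
  refine ⟨C + 2 * K, fun m hm => ?_⟩
  have hm' : (2 : ℝ) ≤ m := by exact_mod_cast hm
  have h1 : (m : ℝ) / ε + 1 ≤ m * m ^ C / ε := by
    rw [div_add_one hε.ne']
    gcongr
    have h2 : (2 : ℝ) ^ C ≤ (m : ℝ) ^ C := by gcongr
    nlinarith
  have h3 : ((m : ℝ) + 1) ^ K ≤ m ^ (2 * K) := by
    rw [pow_mul]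
    gcongr
    nlinarith
  calc ((m : ℝ) / ε + 1) * (m + 1) ^ K ≤ m * m ^ C / ε * m ^ (2 * K) := by gcongr
    _ = 1 * (m : ℝ) ^ (C + 2 * K + 1) / ε := by ring
    _ ≤ 2 * (m : ℝ) ^ (C + 2 * K + 1) / ε := by
      gcongr
      norm_num

theorem exists_node_bound (hε : 0 < ε) :
    ∃ F : ℕ, ∀ (m n : ℕ) (p : Fin n → ℕ) (σ : Equiv.Perm (Fin n)), 1 ≤ m → Antitone (p ∘ σ) →
      (¬ ∃ r : ℕ → State n m, r 0 = initial n m ∧ ∀ k, AlgStep ε m p σ (r k) (r (k + 1))) ∧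
      ∀ s : State n m, Reachable ε m p σ s →
        (s.halted = false → CanProceed ε m p σ s) ∧
        (s.halted = true → ∃ R, Returns σ s R) ∧
        (∀ R, Returns σ s R → ∀ S : Fin n → Fin m,
          makespan (fun j => (p j : ℝ)) R ≤ (1 + ε) ^ 2 * makespan (fun j => (p j : ℝ)) S) ∧
        (2 ≤ m ∨ ε ≤ 2 → (s.processed : ℝ) ≤ 2 * (m : ℝ) ^ (F + 1) / ε) := by
  obtain ⟨V, hV⟩ := exists_finset_load hε (2 * (1 + ε) ^ 2)
  obtain ⟨F, hF⟩ := exists_exponent hε #V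
  refine ⟨F, fun m n p σ hm hσ => ?_⟩
  have hq := scaled_normalized hm hσ
  set q := normalized m p σ with hqdef
  have : Nonempty (Fin m) := ⟨⟨0, hm⟩⟩
  -- The makespan of `S₀` is the value `c` of the invariant.
  obtain ⟨S₀, hS₀⟩ := Finite.exists_min fun S : Fin n → Fin m => makespan q S
  obtain ⟨S₂, hS₂⟩ := exists_makespan_le_two hm hq
  have hroot : Good ε q (makespan q S₀) (fun _ => none : Node n m) :=
    ⟨S₀, fun j i h => by simp at h, makespan_mono hm (roundLarge_le hε) S₀⟩
  have hspec := fun {s : State n m} (hs : Reachable ε m p σ s) =>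
    reachable_spec hm hε hq ((hS₀ S₂).trans hS₂) hroot
      (fun s hs => hs.card_listed_le hε hq fun w h1 h2 => hV n m q w hq.le_one h1 h2) hs
  refine ⟨?_, fun s hs => ⟨fun hh => ?_, fun hh => ?_, ?_, fun hmε => ?_⟩⟩
  · rintro ⟨r, hr0, hr⟩
    have hreach : ∀ k, Reachable ε m p σ (r k) ∧ (r k).processed = k := by
      intro k
      induction k with
      | zero => exact ⟨hr0 ▸ Relation.ReflTransGen.refl, by simp [hr0, initial]⟩
      | succ k ih =>
        refine ⟨ih.1.tail (hr k), ?_⟩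
        have := ((hspec ih.1).1 (hr k).1).1.step hm hε hq ((hS₀ S₂).trans hS₂) hroot (hr k)
        rw [this.1, ih.2]
    obtain ⟨k, hk⟩ := exists_nat_gt (((m : ℝ) / ε + 1) * (m + 1) ^ #V)
    have := (hspec (hreach k).1).2.2
    rw [(hreach k).2] at this
    exact hk.not_ge this
  · obtain ⟨v, hv, hmin⟩ := exists_min_image s.active (lowerBound (globalOpt m p) q)
      ((hspec hs).1 hh).2
    obtain ⟨x, hx⟩ := exists_isVertex hm hq.grid v
    exact ⟨⟨v, x, hv, hmin, hx⟩, fun v x h => exists_processes hq h.2.2⟩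
  · obtain ⟨B, hB, -⟩ := (hspec hs).2.1 hh
    exact ⟨_, hh, B, hB, rfl⟩
  · rintro R ⟨hh, B, hB, rfl⟩ S
    obtain ⟨B', hB', hle⟩ := (hspec hs).2.1 hh
    obtain rfl : B = B' := Option.some.inj (hB.symm.trans hB')
    rw [makespan_eq_mul hm p σ, makespan_eq_mul hm p σ S, mul_left_comm]
    refine mul_le_mul_of_nonneg_left ?_ (Nat.cast_nonneg _)
    simp only [Equiv.symm_apply_apply]
    refine hle.trans (mul_le_mul_of_nonneg_left (hS₀ _) (by positivity))
  · by_cases h2 : 2 ≤ m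
    · exact (hspec hs).2.2.trans (hF m h2)
    · obtain rfl : m = 1 := by omega
      have h3 := (processed_le_one hs).2
      have h4 : (1 : ℝ) ≤ 2 / ε := by
        rw [one_le_div hε]
        exact hmε.resolve_left h2
      refine le_trans (by exact_mod_cast h3) (h4.trans ?_)
      simp

end Executions
end EqProf

theorem theorem4 :
    ∃ f : ℝ → ℕ, ∀ ε : ℝ, 0 < ε →
      ∀ (m n : ℕ) (p : Fin n → ℕ) (σ : Equiv.Perm (Fin n)), 1 ≤ m → Antitone (p ∘ σ) →
        -- no execution is infinite
        (¬ ∃ r : ℕ → EqProf.State n m, r 0 = EqProf.initial n m ∧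
          ∀ k, EqProf.AlgStep ε m p σ (r k) (r (k + 1))) ∧
        ∀ s : EqProf.State n m, EqProf.Reachable ε m p σ s →
          -- no execution gets blocked, and one that stops returns a schedule
          (s.halted = false → EqProf.CanProceed ε m p σ s) ∧
          (s.halted = true → ∃ R, EqProf.Returns σ s R) ∧
          -- every returned schedule is approximately optimal
          (∀ R, EqProf.Returns σ s R → ∀ S : Fin n → Fin m,
            EqProf.makespan (fun j => (p j : ℝ)) R ≤
              (1 + ε) ^ 2 * EqProf.makespan (fun j => (p j : ℝ)) S) ∧
          -- few nodes are processed
          (2 ≤ m ∨ ε ≤ 2 → (s.processed : ℝ) ≤ 2 * (m : ℝ) ^ (f ε + 1) / ε) := by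
  classical
  -- The exponent is chosen separately for each `ε`, with the dummy value 0 for `ε ≤ 0`.
  have h : ∀ ε : ℝ, ∃ F : ℕ, ∀ _ : 0 < ε, _ := fun ε => by
    by_cases hε : 0 < ε
    · obtain ⟨F, hF⟩ := EqProf.exists_node_bound hε
      exact ⟨F, fun _ => hF⟩
    · exact ⟨0, fun h => absurd h hε⟩
  choose f hf using h
  exact ⟨f, hf⟩
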